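/- For integers $m,n$ let $C_{m,n}\subseteq S_{mn}$ be the stabilizer of a partition of the set $\{1,\dots,mn\}$ into $n$ blocks of size $m$ (the wreath product of $S_m$, acting inside the blocks, by $S_n$, permuting the blocks), and let $V_n=\mathrm{Ind}_{C_{3,n}}^{S_{3n}}(1)$ be the complex representation of $S_{3n}$ induced from the trivial representation of $C_{3,n}$. For a finite weakly decreasing sequence $\lambda=(\lambda_1,\dots,\lambda_k)$ of positive integers, the partition of $3n$ with pattern $(*,\lambda)$ is the partition $(3n-\lambda_1-\cdots-\lambda_k,\lambda_1,\dots,\lambda_k)$ of $3n$ into exactly $k+1$ positive parts, when this is a partition. Then: 1. for every $n\ge 5$ and every $$\lambda\in\{\emptyset,\,(2),\,(3),\,(4),\,(2,2),\,(5),\,(4,1),\,(3,2)\},$$ the partition of $3n$ with pattern $(*,\lambda)$ exists and the corresponding Specht module has multiplicity exactly $1$ in $V_n$; 2. for every $n\ge 0$ and every $$\lambda\in\{(1),\,(2,1),\,(3,1),\,(2,2,1),\,(3,1,1),\,(4,1,1)\},$$ if the partition of $3n$ with pattern $(*,\lambda)$ exists, then the corresponding Specht module does not occur in $V_n$. -/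

import Mathlib

open scoped MonoidAlgebra

namespace BV

noncomputable section

/-! ## Induced representation -/

/-- The subgroup `C_{m,n}` of `S_{mn}`: the stabilizer of the set partition of the `mn` points into
the `n` consecutive blocks `{mb, mb + 1, …, mb + m - 1}` of size `m`. As an abstract group it is
the wreath product of `S_m` (acting inside each block) by `S_n` (permuting the blocks). -/
def blockStabilizer (m n : ℕ) : Subgroup (Equiv.Perm (Fin (m * n))) where
  carrier := {σ | ∀ x y : Fin (m * n),
    (σ x : ℕ) / m = (σ y : ℕ) / m ↔ (x : ℕ) / m = (y : ℕ) / m}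
  one_mem' := fun _ _ => Iff.rfl
  mul_mem' := fun {σ τ} hσ hτ x y => (hσ (τ x) (τ y)).trans (hτ x y)
  inv_mem' := fun {σ} hσ x y => by
    have h := hσ (σ⁻¹ x) (σ⁻¹ y)
    simpa using h.symm

/-- The complex representation `Ind_{C_{m,n}}^{S_{mn}}(1)` of `S_{mn}`. -/
abbrev inducedTrivial (m n : ℕ) :=
  Representation.ind (blockStabilizer m n).subtype
    (Representation.trivial ℂ (blockStabilizer m n) ℂ)

/-! ## Specht modules -/

/-- A tabloid of shape `μ` on `N` letters, recorded by the function that sends a letter to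
(the index of) its row: the `i`-th row contains exactly `μ.rowLen i` letters. -/
def Tabloid (μ : YoungDiagram) (N : ℕ) : Type :=
  {r : Fin N → ℕ // ∀ i : ℕ, (Finset.univ.filter fun x => r x = i).card = μ.rowLen i}

/-- The action of `S_N` on tabloids by permuting the letters. -/
instance (μ : YoungDiagram) (N : ℕ) : MulAction (Equiv.Perm (Fin N)) (Tabloid μ N) where
  smul σ r := ⟨fun x => r.1 (σ⁻¹ x), fun i => by
    rw [← r.2 i]
    exact Finset.card_equiv σ⁻¹ (by intro x; simp)⟩
  one_smul _ := rfl
  mul_smul σ τ r := Subtype.ext (funext fun x => by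
    change r.1 ((σ * τ)⁻¹ x) = r.1 (τ⁻¹ (σ⁻¹ x))
    simp [mul_inv_rev])

/-- The permutation module `M^μ` on the tabloids of shape `μ`. -/
def tabloidRep (μ : YoungDiagram) (N : ℕ) :
    Representation ℂ (Equiv.Perm (Fin N)) (Tabloid μ N →₀ ℂ) where
  toFun σ := Finsupp.lmapDomain ℂ ℂ (fun r => σ • r)
  map_one' := by ext; simp
  map_mul' σ τ := by ext; simp [mul_smul]

/-- A tableau of shape `μ` on `N` letters: a bijective filling of the boxes of `μ`. -/
abbrev Tableau (μ : YoungDiagram) (N : ℕ) : Type := {c // c ∈ μ.cells} ≃ Fin N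

/-- The action of `S_N` on tableaux by permuting the letters. -/
def Tableau.perm {μ : YoungDiagram} {N : ℕ} (σ : Equiv.Perm (Fin N)) (t : Tableau μ N) :
    Tableau μ N := t.trans σ

/-- The tabloid `{t}` of a tableau `t`: the row containing each letter. -/
def Tableau.tabloid {μ : YoungDiagram} {N : ℕ} (t : Tableau μ N) : Tabloid μ N :=
  ⟨fun x => (t.symm x).1.1, fun i => by
    rw [YoungDiagram.rowLen_eq_card]
    refine Finset.card_bij (fun x _ => (t.symm x).1) ?_ ?_ ?_
    · intro x hx
      rw [YoungDiagram.mem_row_iff]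
      exact ⟨(YoungDiagram.mem_cells _).1 (t.symm x).2, (Finset.mem_filter.1 hx).2⟩
    · intro x _ y _ h
      exact t.symm.injective (Subtype.ext h)
    · intro c hc
      rw [YoungDiagram.mem_row_iff] at hc
      exact ⟨t ⟨c, (YoungDiagram.mem_cells _).2 hc.1⟩, by simp [hc.2], by simp⟩⟩

/-- The column (index) containing the letter `x` in the tableau `t`. -/
def Tableau.col {μ : YoungDiagram} {N : ℕ} (t : Tableau μ N) (x : Fin N) : ℕ := (t.symm x).1.2

/-- The polytabloid `e_t = ∑ sign(π) π{t}`, summed over the column stabilizer of `t`. -/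
def Tableau.polytabloid {μ : YoungDiagram} {N : ℕ} (t : Tableau μ N) : Tabloid μ N →₀ ℂ :=
  ∑ π : Equiv.Perm (Fin N) with ∀ x, t.col (π x) = t.col x,
    Finsupp.single (π • t.tabloid) ((Equiv.Perm.sign π : ℤ) : ℂ)

/-- Permuting the letters of `t` permutes the polytabloid: `σ e_t = e_{σ t}`. -/
theorem tabloidRep_polytabloid {μ : YoungDiagram} {N : ℕ} (σ : Equiv.Perm (Fin N))
    (t : Tableau μ N) : tabloidRep μ N σ t.polytabloid = (t.perm σ).polytabloid := by
  have hcol : ∀ x, (t.perm σ).col x = t.col (σ⁻¹ x) := fun _ => rfl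
  have htab : (t.perm σ).tabloid = σ • t.tabloid := rfl
  have happ : tabloidRep μ N σ t.polytabloid =
      Finsupp.lmapDomain ℂ ℂ (fun r => σ • r) t.polytabloid := rfl
  rw [happ, Tableau.polytabloid, Tableau.polytabloid, map_sum]
  refine Finset.sum_equiv (MulAut.conj σ).toEquiv ?_ ?_
  · intro π
    simp only [Finset.mem_filter, Finset.mem_univ, true_and, hcol, MulEquiv.toEquiv_eq_coe,
      EquivLike.coe_coe, MulAut.conj_apply, Equiv.Perm.mul_apply]
    constructor
    · intro h x
      simpa using h (σ⁻¹ x)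
    · intro h x
      simpa using h (σ x)
  · intro π _
    have hsign : Equiv.Perm.sign ((MulAut.conj σ).toEquiv π) = Equiv.Perm.sign π := by
      simp [mul_comm, ← mul_assoc]
    have hact : (MulAut.conj σ).toEquiv π • (t.perm σ).tabloid = σ • π • t.tabloid := by
      simp [htab, ← mul_smul]
    rw [hsign, hact]
    simp

/-- The Specht module `S^μ`: the span of the polytabloids inside `M^μ`. -/
def spechtModule (μ : YoungDiagram) (N : ℕ) : Subrepresentation (tabloidRep μ N) where
  toSubmodule := Submodule.span ℂ (Set.range fun t : Tableau μ N => t.polytabloid)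
  apply_mem_toSubmodule σ v hv := by
    induction hv using Submodule.span_induction with
    | mem v h =>
      obtain ⟨t, rfl⟩ := h
      rw [tabloidRep_polytabloid]
      exact Submodule.subset_span ⟨t.perm σ, rfl⟩
    | zero => simp
    | add v w _ _ hv hw => rw [map_add]; exact add_mem hv hw
    | smul a v _ hv => rw [map_smul]; exact Submodule.smul_mem _ a hv

/-! ## Multiplicities and partition patterns -/

/-- The multiplicity of an irreducible representation `σ` in `ρ`: the number of irreducible
constituents (the length) of the `σ`-isotypic component of `ρ`, which is the sum of all
subrepresentations of `ρ` isomorphic to `σ`. -/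
def irrepMultiplicity {G V W : Type*} [Group G] [AddCommGroup V] [Module ℂ V] [AddCommGroup W]
    [Module ℂ W] (σ : Representation ℂ G W) (ρ : Representation ℂ G V) : ℕ∞ :=
  Module.length ℂ[G] (isotypicComponent ℂ[G] ρ.asModule σ.asModule)

/-- `μ` is a partition of `N` represented by the pattern `(*, l)`: its list of
(positive, weakly decreasing) parts is `a :: l` for some first part `a`. -/
def HasPattern (N : ℕ) (l : List ℕ) (μ : YoungDiagram) : Prop :=
  μ.card = N ∧ ∃ a : ℕ, μ.rowLens = a :: l

/-- The multiplicity of `S^μ` in `Ind_{C_{3,n}}^{S_{3n}}(1)`, for `μ` a partition of `3n`. -/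
def mult (μ : YoungDiagram) (n : ℕ) : ℕ∞ :=
  irrepMultiplicity (W := (spechtModule μ (3 * n)).toSubmodule)
    (spechtModule μ (3 * n)).toRepresentation (inducedTrivial 3 n)

end

end BV

/-!
By Frobenius reciprocity the multiplicity of the irreducible Specht module `S^μ` in `V_n` is the
dimension of the space of its vectors fixed by the block stabilizer `C_{3,n}`. Regard a tabloid as
a labelling of the points by their rows. The coefficients of a fixed vector only depend on the
`C_{3,n}`-orbit of the labelling, that is, on its block type: the multiset formed by the multisets
of nonzero labels of the blocks. Since polytabloids are alternating along columns, vectors of `S^μ`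
are killed by the raising operators, which replace one label `j` by a smaller label `i`.

Upper bounds: the relations with `i = 0` express the coefficients at block types having a block
with a single nonzero label through those with fewer blocks, so that the remaining block types,
finitely many independently of `n`, determine the vector. Using a few relations with `0 < i`, each
to solve for one unknown coefficient, all coefficients vanish in the second part of the theorem,
and all vanish as soon as one particular coefficient does in the first part.

Lower bounds: if every element of the column stabilizer of a tableau `t` that sends the tabloid
`{t}` into its `C_{3,n}`-orbit is even, then the average of the polytabloid `e_t` over `C_{3,n}` has
a positive coefficient at `{t}`. For an explicit `t` parity is checked with an invariant of the
orbit, the sum of the products of the labels of all pairs of points lying in a common block.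
-/

namespace BV

open Module Representation

noncomputable section

section Isotypic

variable {k A M S : Type*} [Field k] [Ring A] [AddCommGroup M] [Module A M] [AddCommGroup S]
  [Module A S] [IsSimpleModule A S]

theorem eq_zero_of_isotypicComponent_le_ker [IsSemisimpleModule A M] {f : M →ₗ[A] S}
    (hf : isotypicComponent A M S ≤ LinearMap.ker f) : f = 0 := by
  by_contra hne
  obtain ⟨K, hK⟩ := exists_isCompl (LinearMap.ker f)
  let e : K ≃ₗ[A] S := (Submodule.quotientEquivOfIsCompl _ K hK).symm.trans
    (f.quotKerEquivOfSurjective (LinearMap.surjective_of_ne_zero hne))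
  have hKf : K ≤ LinearMap.ker f := le_trans (le_sSup (Nonempty.intro e)) hf
  exact hne (LinearMap.ker_eq_top.1 (hK.symm.codisjoint.eq_top_of_ge hKf))

variable (k A M S) [Algebra k A] [Module k S] [IsScalarTower k A S]

theorem finrank_isotypicComponent_hom [IsSemisimpleModule A M] :
    finrank k (isotypicComponent A M S →ₗ[A] S) = finrank k (M →ₗ[A] S) := by
  let restrict : (M →ₗ[A] S) →ₗ[k] (isotypicComponent A M S →ₗ[A] S) :=
    LinearMap.lcomp k S (isotypicComponent A M S).subtype
  refine (LinearEquiv.ofBijective restrict ⟨?_, fun f => ?_⟩).finrank_eq.symm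
  · refine (injective_iff_map_eq_zero _).2 fun f hf => ?_
    exact eq_zero_of_isotypicComponent_le_ker fun x hx => LinearMap.congr_fun hf ⟨x, hx⟩
  · exact IsSemisimpleModule.extension_property _ (Submodule.subtype_injective _) f

theorem length_isotypicComponent [IsAlgClosed k] [FiniteDimensional k S] [IsSemisimpleModule A M]
    [Module.Finite A M] :
    Module.length A (isotypicComponent A M S) = finrank k (M →ₗ[A] S) := by
  obtain ⟨n, ⟨e⟩⟩ := (IsIsotypicOfType.isotypicComponent A M S).linearEquiv_fun
  have schur : finrank k (S →ₗ[A] S) = 1 := by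
    rw [← finrank_self k]
    exact (LinearEquiv.ofBijective (Algebra.linearMap k (End A S))
      (IsSimpleModule.algebraMap_end_bijective_of_isAlgClosed k)).finrank_eq.symm
  rw [e.length_eq, ← finrank_isotypicComponent_hom, (e.congrLeft S k).finrank_eq,
    ← (LinearMap.lsum A (fun _ : Fin n => S) k).finrank_eq]
  rw [finrank_pi_fintype]
  simp [schur]

end Isotypic

section Induction

universe u

theorem finrank_hom_trivial {k G W : Type*} [Field k] [Group G] [AddCommGroup W]
    [Module k W] (σ : Representation k G W) :
    finrank k (IntertwiningMap (trivial k G k) σ) = finrank k σ.invariants := by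
  rw [← (invariantsEquivIntertwiningMap _ _).finrank_eq]
  refine ((LinearMap.ringLmapEquivSelf k k W).ofSubmodules _ _ ?_).finrank_eq
  ext w
  simp only [Submodule.mem_map_equiv, mem_invariants]
  refine forall_congr' fun g => ?_
  have : (∀ a : k, a • σ g w = a • w) ↔ σ g w = w :=
    ⟨fun h => by simpa using h 1, fun h a => by rw [h]⟩
  simpa [LinearMap.ext_iff, LinearMap.ringLmapEquivSelf] using this

theorem finrank_hom_ind_trivial {k G W : Type u} [Field k] [Group G] [AddCommGroup W] [Module k W]
    (σ : Representation k G W) (C : Subgroup G) :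
    finrank k (IntertwiningMap (ind C.subtype (trivial k C k)) σ) =
      finrank k (invariants (σ.comp C.subtype)) := by
  rw [← finrank_hom_trivial]
  exact ((Rep.homLinearEquiv (Rep.ind C.subtype (Rep.of (trivial k C k))) (Rep.of σ)).symm ≪≫ₗ
    Rep.indResHomEquiv C.subtype (Rep.of (trivial k C k)) (Rep.of σ) ≪≫ₗ
    Rep.homLinearEquiv (Rep.of (trivial k C k)) (Rep.res C.subtype (Rep.of σ))).finrank_eq

variable {G W : Type} [Group G] [AddCommGroup W] [Module ℂ W] (σ : Representation ℂ G W)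

theorem irrepMultiplicity_ind_trivial [Finite G] [IsIrreducible σ] [FiniteDimensional ℂ W]
    (C : Subgroup G) :
    irrepMultiplicity σ (ind C.subtype (trivial ℂ C ℂ)) =
      finrank ℂ (invariants (σ.comp C.subtype)) := by
  have hind : Module.Finite ℂ (ind C.subtype (trivial ℂ C ℂ)).asModule :=
    Module.Finite.of_surjective _ (Coinvariants.mk_surjective _)
  have : Module.Finite ℂ[G] (ind C.subtype (trivial ℂ C ℂ)).asModule :=
    .of_restrictScalars_finite ℂ _ _
  have : FiniteDimensional ℂ σ.asModule := inferInstanceAs (FiniteDimensional ℂ W)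
  rw [← finrank_hom_ind_trivial, (IntertwiningMap.equivLinearMapAsModule _ _).finrank_eq]
  exact length_isotypicComponent ℂ _ _ _

theorem irrepMultiplicity_ind_trivial_eq_zero_iff [Finite G] [IsIrreducible σ]
    [FiniteDimensional ℂ W] (C : Subgroup G) :
    irrepMultiplicity σ (ind C.subtype (trivial ℂ C ℂ)) = 0 ↔
      invariants (σ.comp C.subtype) = ⊥ := by
  rw [irrepMultiplicity_ind_trivial, Nat.cast_eq_zero, Submodule.finrank_eq_zero]

theorem irrepMultiplicity_ind_trivial_le_one [Finite G] [IsIrreducible σ]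
    [FiniteDimensional ℂ W] (C : Subgroup G) (f : W →ₗ[ℂ] ℂ)
    (hf : ∀ v ∈ invariants (σ.comp C.subtype), f v = 0 → v = 0) :
    irrepMultiplicity σ (ind C.subtype (trivial ℂ C ℂ)) ≤ 1 := by
  rw [irrepMultiplicity_ind_trivial, Nat.cast_le_one, ← finrank_self ℂ]
  refine LinearMap.finrank_le_finrank_of_injective (f := f ∘ₗ Submodule.subtype _)
    ((injective_iff_map_eq_zero _).2 fun v hv => ?_)
  exact Subtype.ext (hf v v.2 hv)

end Induction

theorem exists_isCompl_subrepresentation {k G V : Type*} [Field k] [Group G] [Finite G]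
    [NeZero (Nat.card G : k)] [AddCommGroup V] [Module k V] {ρ : Representation k G V}
    (U : Subrepresentation ρ) : ∃ U', IsCompl U U' :=
  (inferInstance : IsSemisimpleRepresentation ρ).exists_isCompl U

section Specht

variable {μ : YoungDiagram} {N : ℕ}

theorem smul_tabloid_apply (π : Equiv.Perm (Fin N)) (r : Tabloid μ N) (x : Fin N) :
    (π • r).1 x = r.1 (π⁻¹ x) := rfl

theorem tabloidRep_single (π : Equiv.Perm (Fin N)) (r : Tabloid μ N) (a : ℂ) :
    tabloidRep μ N π (Finsupp.single r a) = Finsupp.single (π • r) a :=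
  Finsupp.mapDomain_single

theorem card_tabloid_lt (r : Tabloid μ N) (i : ℕ) :
    (Finset.univ.filter fun x => r.1 x < i).card = ∑ k ∈ Finset.range i, μ.rowLen k := by
  rw [Finset.card_eq_sum_card_fiberwise (f := r.1) (t := Finset.range i)
    fun x hx => Finset.mem_range.2 (Finset.mem_filter.1 hx).2]
  refine Finset.sum_congr rfl fun k hk => ?_
  rw [← r.2 k, Finset.filter_filter]
  congr 1 with x
  simp only [Finset.mem_filter, Finset.mem_univ, true_and, and_iff_right_iff_imp]
  rintro rfl
  exact Finset.mem_range.1 hk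

theorem exists_tableau (h : μ.card = N) : Nonempty (Tableau μ N) :=
  ⟨Fintype.equivOfCardEq (by rw [Fintype.card_coe, Fintype.card_fin]; exact h)⟩

namespace Tableau

variable (t : Tableau μ N)

theorem mem_shape (x : Fin N) : (t.tabloid.1 x, t.col x) ∈ μ :=
  (YoungDiagram.mem_cells _).1 (t.symm x).2

theorem tabloid_injOn_col {x y : Fin N} (hcol : t.col x = t.col y)
    (hrow : t.tabloid.1 x = t.tabloid.1 y) : x = y :=
  t.symm.injective (Subtype.ext (Prod.ext hrow hcol))

theorem exists_row_col {i c : ℕ} (h : (i, c) ∈ μ) : ∃ x, t.tabloid.1 x = i ∧ t.col x = c :=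
  ⟨t ⟨(i, c), (YoungDiagram.mem_cells _).2 h⟩, by simp [tabloid], by simp [col]⟩

/-- The column stabilizer of a tableau. -/
def colStab : Subgroup (Equiv.Perm (Fin N)) where
  carrier := {π | ∀ x, t.col (π x) = t.col x}
  one_mem' := fun _ => rfl
  mul_mem' := fun hπ hτ x => (hπ _).trans (hτ x)
  inv_mem' := fun {π} hπ x => by simpa using (hπ (π⁻¹ x)).symm

instance : Fintype t.colStab := Fintype.ofFinite _

variable {t} in
theorem mem_colStab {π : Equiv.Perm (Fin N)} : π ∈ t.colStab ↔ ∀ x, t.col (π x) = t.col x :=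
  Iff.rfl

variable {t} in
theorem swap_mem_colStab {x y : Fin N} (h : t.col x = t.col y) :
    Equiv.swap x y ∈ t.colStab := fun z => by
  rw [Equiv.swap_apply_def]
  split_ifs with hx hy
  · rw [hx, h]
  · rw [hy, h]
  · rfl

theorem polytabloid_eq_sum : t.polytabloid =
    ∑ π : t.colStab, Finsupp.single (π.1 • t.tabloid) ((Equiv.Perm.sign π.1 : ℤ) : ℂ) :=
  Finset.sum_subtype (Finset.univ.filter fun π => ∀ x, t.col (π x) = t.col x)
    (p := (· ∈ t.colStab)) (by simp [mem_colStab]) _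

theorem eq_one_of_smul_tabloid_eq {π : Equiv.Perm (Fin N)} (hπ : π ∈ t.colStab)
    (h : π • t.tabloid = t.tabloid) : π = 1 := by
  refine Equiv.ext fun x => t.tabloid_injOn_col (hπ x) ?_
  simpa [smul_tabloid_apply] using (congrFun (congrArg Subtype.val h) (π x)).symm

theorem polytabloid_apply_tabloid : t.polytabloid t.tabloid = 1 := by
  classical
  rw [polytabloid_eq_sum, Finsupp.finsetSum_apply, Finset.sum_eq_single 1]
  · simp
  · intro π _ hπ
    refine Finsupp.single_eq_of_ne fun h => hπ (Subtype.ext ?_)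
    exact t.eq_one_of_smul_tabloid_eq π.2 h.symm
  · exact fun h => absurd (Finset.mem_univ _) h

theorem polytabloid_ne_zero : t.polytabloid ≠ 0 := fun h => by
  simpa [h] using t.polytabloid_apply_tabloid

section SignedColumnSum

variable {V : Type*} [AddCommGroup V] [Module ℂ V] (ρ : Representation ℂ (Equiv.Perm (Fin N)) V)

/-- The action on `ρ` of the signed column sum `κ_t = ∑ sign(π) π`, summed over the column
stabilizer of `t`. -/
def signedColSum : V →ₗ[ℂ] V := ∑ π : t.colStab, ((Equiv.Perm.sign π.1 : ℤ) : ℂ) • ρ π.1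

theorem signedColSum_apply (v : V) :
    t.signedColSum ρ v = ∑ π : t.colStab, ((Equiv.Perm.sign π.1 : ℤ) : ℂ) • ρ π.1 v := by
  simp [signedColSum]

theorem signedColSum_apply_apply (τ : t.colStab) (v : V) :
    t.signedColSum ρ (ρ τ.1 v) = ((Equiv.Perm.sign τ.1 : ℤ) : ℂ) • t.signedColSum ρ v := by
  rw [signedColSum_apply, signedColSum_apply, Finset.smul_sum]
  refine Fintype.sum_equiv (Equiv.mulRight τ) _ _ fun π => ?_
  rcases Int.units_eq_one_or (Equiv.Perm.sign τ.1) with h | h <;> simp [h]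

variable {ρ} in
theorem signedColSum_mem (U : Subrepresentation ρ) {u : V} (hu : u ∈ U) :
    t.signedColSum ρ u ∈ U := by
  rw [signedColSum_apply]
  exact U.toSubmodule.sum_mem fun π _ => U.toSubmodule.smul_mem _ (U.apply_mem_toSubmodule _ hu)

variable {ρ} in
theorem coe_signedColSum_toRepresentation (U : Subrepresentation ρ) (u : U.toSubmodule) :
    (t.signedColSum U.toRepresentation u : V) = t.signedColSum ρ u := by
  rw [signedColSum_apply, signedColSum_apply, Submodule.coe_sum]
  rfl

end SignedColumnSum

theorem signedColSum_single_tabloid :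
    t.signedColSum (tabloidRep μ N) (Finsupp.single t.tabloid 1) = t.polytabloid := by
  simp [signedColSum_apply, polytabloid_eq_sum, tabloidRep_single]

theorem signedColSum_polytabloid :
    t.signedColSum (tabloidRep μ N) t.polytabloid =
      (Fintype.card t.colStab : ℂ) • t.polytabloid := by
  have hterm (π : t.colStab) : t.signedColSum (tabloidRep μ N)
      (Finsupp.single (π.1 • t.tabloid) ((Equiv.Perm.sign π.1 : ℤ) : ℂ)) = t.polytabloid := by
    rw [← mul_one ((Equiv.Perm.sign π.1 : ℤ) : ℂ), ← smul_eq_mul, ← Finsupp.smul_single,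
      ← tabloidRep_single, map_smul, signedColSum_apply_apply,
      signedColSum_single_tabloid, smul_smul]
    rcases Int.units_eq_one_or (Equiv.Perm.sign π.1) with h | h <;> simp [h]
  nth_rewrite 1 [polytabloid_eq_sum]
  rw [map_sum, Finset.sum_congr rfl fun π _ => hterm π, Finset.sum_const, Finset.card_univ,
    Nat.cast_smul_eq_nsmul]

theorem signedColSum_single_eq_zero {r : Tabloid μ N} {x y : Fin N} (hxy : x ≠ y)
    (hcol : t.col x = t.col y) (hr : r.1 x = r.1 y) :
    t.signedColSum (tabloidRep μ N) (Finsupp.single r 1) = 0 := by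
  have hswap : Equiv.swap x y • r = r :=
    Subtype.ext (funext fun z => Equiv.apply_swap_eq_self hr z)
  have hneg := t.signedColSum_apply_apply (tabloidRep μ N) ⟨_, swap_mem_colStab hcol⟩
    (Finsupp.single r 1)
  rw [tabloidRep_single, hswap, Equiv.Perm.sign_swap hxy] at hneg
  exact self_eq_neg.1 (by simpa using hneg)

theorem card_row_lt_and_col_eq (i c : ℕ) :
    (Finset.univ.filter fun x => t.tabloid.1 x < i ∧ t.col x = c).card = min i (μ.colLen c) := by
  rw [← Finset.card_range (min i (μ.colLen c))]
  refine Finset.card_nbij t.tabloid.1 (fun x hx => ?_) (fun x hx y hy => ?_) fun k hk => ?_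
  · obtain ⟨hi, rfl⟩ := (Finset.mem_filter.1 hx).2
    simpa [hi] using YoungDiagram.mem_iff_lt_colLen.1 (t.mem_shape x)
  · exact t.tabloid_injOn_col
      ((Finset.mem_filter.1 hx).2.2.trans (Finset.mem_filter.1 hy).2.2.symm)
  · obtain ⟨hki, hkc⟩ := lt_min_iff.1 (Finset.mem_range.1 hk)
    obtain ⟨x, rfl, hx⟩ := t.exists_row_col (YoungDiagram.mem_iff_lt_colLen.2 hkc)
    exact ⟨x, by simp [hki, hx], rfl⟩

theorem card_col_eq (c : ℕ) : (Finset.univ.filter fun x => t.col x = c).card = μ.colLen c := by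
  rw [← min_self (μ.colLen c), ← t.card_row_lt_and_col_eq]
  congr 1 with x
  simp only [Finset.mem_filter, Finset.mem_univ, true_and, iff_and_self]
  rintro rfl
  exact YoungDiagram.mem_iff_lt_colLen.1 (t.mem_shape x)

variable {t}

theorem mem_shape_of_injOn_col {r : Tabloid μ N}
    (hr : ∀ x y, t.col x = t.col y → r.1 x = r.1 y → x = y) (x : Fin N) :
    (r.1 x, t.col x) ∈ μ := by
  -- For every `i`, the letters in the first `i` rows of `r` are at most as many in each column as
  -- those of `{t}`, and equally many in total, so they are equally many in each column.
  have hle (i c : ℕ) : (Finset.univ.filter fun x => r.1 x < i ∧ t.col x = c).card ≤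
      (Finset.univ.filter fun x => t.tabloid.1 x < i ∧ t.col x = c).card := by
    rw [t.card_row_lt_and_col_eq, ← t.card_col_eq, le_min_iff]
    refine ⟨?_, Finset.card_le_card (Finset.monotone_filter_right _ fun _ _ h => And.right h)⟩
    refine (Finset.card_le_card_of_injOn (t := Finset.range i) r.1
      (fun x hx => Finset.mem_range.2 (Finset.mem_filter.1 hx).2.1)
      fun x hx y hy => ?_).trans_eq (Finset.card_range i)
    exact hr x y ((Finset.mem_filter.1 hx).2.2.trans (Finset.mem_filter.1 hy).2.2.symm)
  have hsplit (s : Tabloid μ N) (i : ℕ) : (Finset.univ.filter fun x => s.1 x < i).card =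
      ∑ c ∈ Finset.univ.image t.col,
        (Finset.univ.filter fun x => s.1 x < i ∧ t.col x = c).card := by
    simp only [← Finset.filter_filter]
    exact Finset.card_eq_sum_card_fiberwise fun x _ => by simp
  have heq (i : ℕ) : (Finset.univ.filter fun y => r.1 y < i ∧ t.col y = t.col x).card =
      min i (μ.colLen (t.col x)) := by
    rw [← t.card_row_lt_and_col_eq]
    refine (Finset.sum_eq_sum_iff_of_le fun c _ => hle i c).1 ?_ _
      (Finset.mem_image_of_mem _ (Finset.mem_univ x))
    rw [← hsplit, ← hsplit, card_tabloid_lt, card_tabloid_lt]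
  have hfull := Finset.eq_of_subset_of_card_le
    (Finset.monotone_filter_right Finset.univ fun y _ (hy : r.1 y < μ.colLen (t.col x) ∧
      t.col y = t.col x) => hy.2) (by rw [heq, min_self, t.card_col_eq])
  have hx : x ∈ Finset.univ.filter fun y => t.col y = t.col x := by simp
  rw [← hfull] at hx
  exact YoungDiagram.mem_iff_lt_colLen.2 (Finset.mem_filter.1 hx).2.1

theorem exists_colStab_smul_tabloid_eq {r : Tabloid μ N}
    (hr : ∀ x y, t.col x = t.col y → r.1 x = r.1 y → x = y) :
    ∃ π : t.colStab, π.1 • t.tabloid = r := by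
  choose f hrow hcol using fun x => t.exists_row_col (mem_shape_of_injOn_col hr x)
  have hf : Function.Injective f := fun x y hxy =>
    hr x y (by rw [← hcol x, ← hcol y, hxy]) (by rw [← hrow x, ← hrow y, hxy])
  let π : t.colStab := ⟨Equiv.ofBijective f (Finite.injective_iff_bijective.1 hf), hcol⟩
  refine ⟨π⁻¹, Subtype.ext (funext fun x => ?_)⟩
  rw [smul_tabloid_apply]
  simpa [π] using hrow x

variable (t)

theorem signedColSum_mem_span (v : Tabloid μ N →₀ ℂ) :
    t.signedColSum (tabloidRep μ N) v ∈ Submodule.span ℂ {t.polytabloid} := by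
  induction v using Finsupp.induction_linear with
  | zero => simp
  | add v w hv hw => rw [map_add]; exact add_mem hv hw
  | single r a =>
    rw [← mul_one a, ← smul_eq_mul, ← Finsupp.smul_single, map_smul]
    refine Submodule.smul_mem _ _ ?_
    by_cases hr : ∀ x y, t.col x = t.col y → r.1 x = r.1 y → x = y
    · obtain ⟨π, rfl⟩ := exists_colStab_smul_tabloid_eq hr
      rw [← tabloidRep_single, signedColSum_apply_apply, signedColSum_single_tabloid]
      exact Submodule.smul_mem _ _ (Submodule.mem_span_singleton_self _)
    · push Not at hr
      obtain ⟨x, y, hcol, hrow, hxy⟩ := hr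
      rw [t.signedColSum_single_eq_zero hxy hcol hrow]
      exact zero_mem _

/-- The polytabloid `e_t` as a vector of the Specht module. -/
def spechtPolytabloid : (spechtModule μ N).toSubmodule :=
  ⟨t.polytabloid, Submodule.subset_span ⟨t, rfl⟩⟩

variable {t}

theorem eq_top_of_spechtPolytabloid_mem {U : Subrepresentation (spechtModule μ N).toRepresentation}
    (ht : t.spechtPolytabloid ∈ U) : U = ⊤ := by
  have hle : (spechtModule μ N).toSubmodule ≤
      U.toSubmodule.map (spechtModule μ N).toSubmodule.subtype := by
    refine Submodule.span_le.2 ?_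
    rintro _ ⟨s, rfl⟩
    have hs : (s : Tableau μ N) = t.perm (t.symm.trans s) := by ext; simp [perm]
    refine ⟨_, U.apply_mem_toSubmodule (t.symm.trans s) ht, ?_⟩
    exact (tabloidRep_polytabloid _ t).trans (congrArg polytabloid hs.symm)
  refine SetLike.ext fun v => ⟨fun _ => trivial, fun _ => ?_⟩
  obtain ⟨u, hu, huv⟩ := hle v.2
  rwa [← Subtype.ext huv]

theorem eq_top_of_signedColSum_ne_zero {U : Subrepresentation (spechtModule μ N).toRepresentation}
    {u : (spechtModule μ N).toSubmodule} (hu : u ∈ U) (h : t.signedColSum (tabloidRep μ N) u ≠ 0) :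
    U = ⊤ := by
  obtain ⟨a, ha⟩ := Submodule.mem_span_singleton.1 (t.signedColSum_mem_span u)
  have ha0 : a ≠ 0 := by rintro rfl; exact h (by rw [← ha, zero_smul])
  have hut : t.signedColSum (spechtModule μ N).toRepresentation u = a • t.spechtPolytabloid :=
    Subtype.ext ((t.coe_signedColSum_toRepresentation _ u).trans ha.symm)
  refine eq_top_of_spechtPolytabloid_mem (t := t) ?_
  rw [← inv_smul_smul₀ ha0 t.spechtPolytabloid, ← hut]
  have hκ := t.signedColSum_mem (V := (spechtModule μ N).toSubmodule) U hu
  exact U.toSubmodule.smul_mem _ hκ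

end Tableau

theorem isIrreducible_specht (h : μ.card = N) :
    IsIrreducible (V := (spechtModule μ N).toSubmodule) (spechtModule μ N).toRepresentation := by
  obtain ⟨t⟩ := exists_tableau h
  have : Nontrivial (spechtModule μ N).toSubmodule :=
    ⟨t.spechtPolytabloid, 0, fun h => t.polytabloid_ne_zero (congrArg Subtype.val h)⟩
  have : Nontrivial (Subrepresentation (spechtModule μ N).toRepresentation) :=
    ⟨⊥, ⊤, fun h => bot_ne_top (congrArg Subrepresentation.toSubmodule h)⟩
  refine ⟨fun U => ?_⟩
  obtain ⟨U', hU⟩ := exists_isCompl_subrepresentation (V := (spechtModule μ N).toSubmodule) U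
  have ht : t.spechtPolytabloid ∈ (U ⊔ U').toSubmodule := by rw [hU.sup_eq_top]; trivial
  obtain ⟨u, hu, u', hu', huu'⟩ := Submodule.mem_sup.1 ht
  have hsum : t.signedColSum (tabloidRep μ N) u + t.signedColSum (tabloidRep μ N) u' ≠ 0 := by
    rw [← map_add, ← Submodule.coe_add, huu']
    refine (t.signedColSum_polytabloid).trans_ne (smul_ne_zero ?_ t.polytabloid_ne_zero)
    exact Nat.cast_ne_zero.2 Fintype.card_ne_zero
  by_cases hκ : t.signedColSum (tabloidRep μ N) u = 0
  · rw [hκ, zero_add] at hsum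
    rw [Tableau.eq_top_of_signedColSum_ne_zero hu' hsum] at hU
    exact .inl (by simpa using hU.inf_eq_bot)
  · exact .inr (Tableau.eq_top_of_signedColSum_ne_zero hu hκ)

end Specht

section Coeff

variable {μ : YoungDiagram} {N : ℕ}

/-- The coefficient of the tabloid with row function `r`, as a linear form on `M^μ`. It is zero if
`r` is not the row function of a tabloid of shape `μ`. -/
def coeff (r : Fin N → ℕ) : (Tabloid μ N →₀ ℂ) →ₗ[ℂ] ℂ :=
  Finsupp.lapply r ∘ₗ Finsupp.lmapDomain ℂ ℂ Subtype.val

theorem coeff_tabloid (r : Tabloid μ N) (v : Tabloid μ N →₀ ℂ) : coeff r.1 v = v r :=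
  Finsupp.mapDomain_apply Subtype.val_injective v r

theorem card_row_eq_of_coeff_ne_zero {v : Tabloid μ N →₀ ℂ} {r : Fin N → ℕ} (h : coeff r v ≠ 0)
    (i : ℕ) : (Finset.univ.filter fun x => r x = i).card = μ.rowLen i := by
  obtain ⟨s, rfl⟩ : r ∈ Set.range (Subtype.val : Tabloid μ N → _) := by
    by_contra hr
    exact h (Finsupp.mapDomain_of_notMem_range _ _ hr)
  exact s.2 i

theorem eq_zero_of_coeff_eq_zero {v : Tabloid μ N →₀ ℂ} (h : ∀ r, coeff r v = 0) : v = 0 :=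
  Finsupp.ext fun r => by rw [← coeff_tabloid, h, Finsupp.coe_zero, Pi.zero_apply]

theorem coeff_single (r : Fin N → ℕ) (s : Tabloid μ N) (a : ℂ) :
    coeff r (Finsupp.single s a) = if s.1 = r then a else 0 := by
  exact (DFunLike.congr_fun Finsupp.mapDomain_single r).trans Finsupp.single_apply

theorem coeff_tabloidRep (σ : Equiv.Perm (Fin N)) (v : Tabloid μ N →₀ ℂ) (r : Fin N → ℕ) :
    coeff r (tabloidRep μ N σ v) = coeff (r ∘ σ) v := by
  induction v using Finsupp.induction_linear with
  | zero => simp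
  | add v w hv hw => simp only [map_add, hv, hw]
  | single s a =>
    rw [tabloidRep_single, coeff_single, coeff_single]
    exact if_congr (Equiv.comp_symm_eq σ r s.1) rfl rfl

namespace Tableau

variable (t : Tableau μ N)

theorem coeff_polytabloid (r : Fin N → ℕ) : coeff r t.polytabloid =
    ∑ π : t.colStab with r ∘ π.1 = t.tabloid.1, ((Equiv.Perm.sign π.1 : ℤ) : ℂ) := by
  rw [polytabloid_eq_sum, map_sum, Finset.sum_filter]
  refine Finset.sum_congr rfl fun π _ => ?_
  rw [coeff_single]
  exact if_congr ((Equiv.comp_symm_eq π.1 r t.tabloid.1).trans eq_comm) rfl rfl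

theorem sum_sign_comp_eq_zero {x y : Fin N} (hxy : x ≠ y) (hcol : t.col x = t.col y)
    {s : Fin N → ℕ} (hs : s x = s y) (r : Fin N → ℕ) :
    ∑ π : t.colStab with r ∘ π.1 = s, ((Equiv.Perm.sign π.1 : ℤ) : ℂ) = 0 := by
  let τ : t.colStab := ⟨Equiv.swap x y, swap_mem_colStab hcol⟩
  have hτ : s ∘ τ.1 = s := funext fun z => Equiv.apply_swap_eq_self hs z
  refine Finset.sum_involution (fun π _ => π * τ) ?_ ?_ ?_ ?_
  · intro π _
    simp [τ, Equiv.Perm.sign_swap hxy]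
  · intro π _ _ h
    exact hxy (Equiv.swap_eq_one_iff.1 (congrArg Subtype.val (mul_eq_left.1 h)))
  · intro π hπ
    rw [Finset.mem_filter] at hπ ⊢
    refine ⟨Finset.mem_univ _, ?_⟩
    calc r ∘ (π * τ).1 = (r ∘ π.1) ∘ τ.1 := rfl
      _ = s := by rw [hπ.2, hτ]
  · intro π _
    exact Subtype.ext (by simp [τ, mul_assoc])

theorem sum_coeff_update_polytabloid (i j : ℕ) (r : Fin N → ℕ) :
    ∑ x with r x = i, coeff (Function.update r x j) t.polytabloid =
      ∑ z with t.tabloid.1 z = j, ∑ π : t.colStab with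
        r ∘ π.1 = Function.update t.tabloid.1 z i, ((Equiv.Perm.sign π.1 : ℤ) : ℂ) := by
  have hupdate (π : t.colStab) (z : Fin N) :
      (r (π.1 z) = i ∧ Function.update r (π.1 z) j ∘ π.1 = t.tabloid.1) ↔
        (t.tabloid.1 z = j ∧ r ∘ π.1 = Function.update t.tabloid.1 z i) := by
    rw [Function.update_comp_eq_of_injective _ π.1.injective, Function.update_eq_iff,
      Function.eq_update_iff, and_left_comm, eq_comm (a := j)]
    rfl
  simp only [coeff_polytabloid]
  rw [Finset.sum_comm' (t' := Finset.univ) (s' := fun π : t.colStab => Finset.univ.filter fun x =>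
      r x = i ∧ Function.update r x j ∘ π.1 = t.tabloid.1) (by simp),
    Finset.sum_comm' (t' := Finset.univ) (s' := fun π : t.colStab => Finset.univ.filter fun z =>
      t.tabloid.1 z = j ∧ r ∘ π.1 = Function.update t.tabloid.1 z i) (by simp)]
  refine Finset.sum_congr rfl fun π _ => (Finset.sum_equiv π.1 (fun z => ?_) fun _ _ => rfl).symm
  simp only [Finset.mem_filter, Finset.mem_univ, true_and, hupdate]

/-- The sum is the coefficient at `r` of the raising operator that changes a label `j` to `i`. -/
theorem raising_polytabloid {i j : ℕ} (hij : i < j) (r : Fin N → ℕ) :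
    ∑ x with r x = i, coeff (Function.update r x j) t.polytabloid = 0 := by
  rw [sum_coeff_update_polytabloid]
  refine Finset.sum_eq_zero fun z hz => ?_
  rw [Finset.mem_filter] at hz
  obtain ⟨w, hw, hwz⟩ := t.exists_row_col
    (μ.up_left_mem (hij.le.trans hz.2.ge) le_rfl (t.mem_shape z))
  have hne : w ≠ z := by rintro rfl; omega
  refine t.sum_sign_comp_eq_zero hne hwz ?_ r
  rw [Function.update_of_ne hne, Function.update_self, hw]

end Tableau

theorem raising_specht {v : Tabloid μ N →₀ ℂ} (hv : v ∈ (spechtModule μ N).toSubmodule)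
    {i j : ℕ} (hij : i < j) (r : Fin N → ℕ) :
    ∑ x with r x = i, coeff (Function.update r x j) v = 0 := by
  have hle : (spechtModule μ N).toSubmodule ≤
      LinearMap.ker (∑ x with r x = i, coeff (Function.update r x j)) := by
    refine Submodule.span_le.2 ?_
    rintro _ ⟨t, rfl⟩
    simpa [LinearMap.sum_apply] using t.raising_polytabloid hij r
  simpa [LinearMap.sum_apply] using hle hv

end Coeff

section NonzeroValues

variable {α β : Type*} [Fintype α] [DecidableEq β] [Zero β] {f g : α → β}

/-- The multiset of the nonzero values of a function on a finite type. -/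
def nonzeroValues (f : α → β) : Multiset β := (Finset.univ.val.map f).filter (· ≠ 0)

theorem mem_nonzeroValues {y : β} : y ∈ nonzeroValues f ↔ y ≠ 0 ∧ ∃ x, f x = y := by
  simp [nonzeroValues, and_comm]

theorem zero_notMem_nonzeroValues (f : α → β) : 0 ∉ nonzeroValues f := by simp [nonzeroValues]

theorem count_nonzeroValues (f : α → β) {y : β} (hy : y ≠ 0) :
    (nonzeroValues f).count y = Fintype.card {x // f x = y} := by
  rw [nonzeroValues, Multiset.count_filter_of_pos (p := (· ≠ 0)) hy, Multiset.count_map,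
    Fintype.card_subtype]
  simp only [eq_comm (a := y)]
  rfl

theorem nonzeroValues_add_replicate (f : α → β) :
    nonzeroValues f + Multiset.replicate (Fintype.card {x // f x = 0}) 0 =
      Finset.univ.val.map f := by
  rw [← Multiset.filter_add_not (· ≠ 0) (Finset.univ.val.map f), nonzeroValues, add_right_inj,
    eq_comm, Multiset.eq_replicate, ← Multiset.countP_eq_card_filter, Multiset.countP_map,
    Fintype.card_subtype]
  exact ⟨by simp only [not_not]; rfl, by simp⟩

theorem card_nonzeroValues_add (f : α → β) :
    (nonzeroValues f).card + Fintype.card {x // f x = 0} = Fintype.card α := by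
  simpa using congrArg Multiset.card (nonzeroValues_add_replicate f)

theorem card_nonzeroValues_le (f : α → β) : (nonzeroValues f).card ≤ Fintype.card α :=
  Nat.le.intro (card_nonzeroValues_add f)

theorem sum_apply_eq_sum_nonzeroValues {R : Type*} [AddCommMonoid R] (f : α → β) (Φ : β → R) :
    ∑ x, Φ (f x) =
      ((nonzeroValues f).map Φ).sum + (Fintype.card {x // f x = 0}) • Φ 0 := by
  calc ∑ x, Φ (f x) = ((Finset.univ.val.map f).map Φ).sum := by rw [Multiset.map_map]; rfl
    _ = _ := by simp [← nonzeroValues_add_replicate f]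

theorem exists_perm_of_nonzeroValues_eq (h : nonzeroValues f = nonzeroValues g) :
    ∃ e : Equiv.Perm α, g ∘ e = f := by
  have hcard (y : β) : Fintype.card {x // f x = y} = Fintype.card {x // g x = y} := by
    rcases eq_or_ne y 0 with rfl | hy
    · have hf := card_nonzeroValues_add f
      rw [h, ← card_nonzeroValues_add g] at hf
      exact Nat.add_left_cancel hf
    · rw [← count_nonzeroValues f hy, ← count_nonzeroValues g hy, h]
  exact ⟨Equiv.ofFiberEquiv fun y => Fintype.equivOfCardEq (hcard y),
    funext fun x => Equiv.ofFiberEquiv_map _ x⟩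

theorem nonzeroValues_update [DecidableEq α] (f : α → β) (a : α) {y : β} (hy : y ≠ 0) :
    nonzeroValues (Function.update f a y) = y ::ₘ (nonzeroValues f).erase (f a) := by
  have hsplit : Finset.univ.val = a ::ₘ Finset.univ.val.erase a :=
    (Multiset.cons_erase (Finset.mem_univ a)).symm
  have hrest : (Finset.univ.val.erase a).map (Function.update f a y) =
      (Finset.univ.val.erase a).map f := by
    refine Multiset.map_congr rfl fun x hx => Function.update_of_ne ?_ _ _
    exact (Finset.univ.nodup.mem_erase_iff.1 hx).1
  rw [nonzeroValues, nonzeroValues, hsplit, Multiset.map_cons, Multiset.map_cons, hrest,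
    Function.update_self, Multiset.filter_cons_of_pos (p := (· ≠ 0)) _ hy]
  by_cases ha : f a = 0
  · rw [Multiset.filter_cons_of_neg (p := (· ≠ 0)) _ (not_not.2 ha), ha]
    exact congrArg _ (Multiset.erase_of_notMem (by simp)).symm
  · rw [Multiset.filter_cons_of_pos (p := (· ≠ 0)) _ ha, Multiset.erase_cons_head]

theorem exists_nonzeroValues_eq {M : Multiset β} (hcard : M.card ≤ Fintype.card α) (h0 : 0 ∉ M) :
    ∃ f : α → β, nonzeroValues f = M := by
  classical
  induction M using Multiset.induction with
  | empty =>
    refine ⟨fun _ => 0, Multiset.eq_zero_of_forall_notMem fun y hy => ?_⟩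
    obtain ⟨hy0, _, rfl⟩ := mem_nonzeroValues.1 hy
    exact hy0 rfl
  | cons y M ih =>
    rw [Multiset.card_cons] at hcard
    rw [Multiset.mem_cons, not_or] at h0
    obtain ⟨f, rfl⟩ := ih (Nat.le_of_succ_le hcard) h0.2
    have hpos : 0 < Fintype.card {x // f x = 0} := by
      have := card_nonzeroValues_add f
      omega
    obtain ⟨⟨x, hx⟩⟩ := Fintype.card_pos_iff.1 hpos
    exact ⟨Function.update f x y, by
      rw [nonzeroValues_update f x (Ne.symm h0.1), hx, Multiset.erase_of_notMem h0.2]⟩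

end NonzeroValues

section BlockType

variable {m n : ℕ}

/-- The `s`-th point of the `b`-th block. -/
def blockPoint : Fin n × Fin m ≃ Fin (m * n) :=
  finProdFinEquiv.trans (finCongr (Nat.mul_comm n m))

theorem blockPoint_div (y : Fin n × Fin m) : (blockPoint y : ℕ) / m = y.1 := by
  have hm : 0 < m := y.2.pos
  simp [blockPoint, finProdFinEquiv, Nat.add_mul_div_left _ _ hm]

theorem blockPoint_prodShear_mem (σ : Equiv.Perm (Fin n)) (τ : Fin n → Equiv.Perm (Fin m)) :
    blockPoint.permCongr (Equiv.prodShear σ τ) ∈ blockStabilizer m n := by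
  intro x y
  obtain ⟨x, rfl⟩ := blockPoint.surjective x
  obtain ⟨y, rfl⟩ := blockPoint.surjective y
  simp [Equiv.permCongr_apply, blockPoint_div, Fin.val_inj]

/-- The multiset of the nonzero labels in the `b`-th block. -/
def blockLabels (r : Fin (m * n) → ℕ) (b : Fin n) : Multiset ℕ :=
  nonzeroValues fun s => r (blockPoint (b, s))

/-- The orbit of a labelling `r` under the block stabilizer, encoded as the multiset of the blocks
with a nonzero label, each block being the multiset of its nonzero labels. -/
def blockType (r : Fin (m * n) → ℕ) : Multiset (Multiset ℕ) := nonzeroValues (blockLabels r)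

theorem blockLabels_update (r : Fin (m * n) → ℕ) (y : Fin n × Fin m) {j : ℕ} (hj : j ≠ 0) :
    blockLabels (Function.update r (blockPoint y) j) =
      Function.update (blockLabels r) y.1 (j ::ₘ (blockLabels r y.1).erase (r (blockPoint y))) := by
  obtain ⟨b, s⟩ := y
  funext c
  have hcomp : (fun s' => Function.update r (blockPoint (b, s)) j (blockPoint (c, s'))) =
      fun s' => Function.update (r ∘ blockPoint) (b, s) j (c, s') := by
    rw [← Function.update_comp_eq_of_injective _ blockPoint.injective]
    rfl
  rw [blockLabels, hcomp]
  rcases eq_or_ne c b with rfl | hc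
  · rw [Function.update_self, blockLabels, ← nonzeroValues_update _ s hj]
    congr 1
    funext s'
    simp [Function.update_apply]
  · rw [Function.update_of_ne hc, blockLabels]
    congr 1
    funext s'
    simp [hc]

theorem blockType_update (r : Fin (m * n) → ℕ) (y : Fin n × Fin m) {j : ℕ} (hj : j ≠ 0) :
    blockType (Function.update r (blockPoint y) j) =
      (j ::ₘ (blockLabels r y.1).erase (r (blockPoint y))) ::ₘ
        (blockType r).erase (blockLabels r y.1) := by
  rw [blockType, blockLabels_update r y hj,
    nonzeroValues_update _ _ (Multiset.cons_ne_zero), blockType]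

theorem exists_comp_eq_of_blockType_eq {r r' : Fin (m * n) → ℕ} (h : blockType r = blockType r') :
    ∃ c ∈ blockStabilizer m n, r' ∘ c = r := by
  obtain ⟨σ, hσ⟩ := exists_perm_of_nonzeroValues_eq h
  choose τ hτ using fun b => exists_perm_of_nonzeroValues_eq (congrFun hσ b).symm
  refine ⟨_, blockPoint_prodShear_mem σ τ, funext fun x => ?_⟩
  obtain ⟨y, rfl⟩ := blockPoint.surjective x
  simpa [Equiv.permCongr_apply] using congrFun (hτ y.1) y.2

/-- The multisets arising as block types of labellings of `n` blocks of size `m`. -/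
def IsBlockType (m n : ℕ) (M : Multiset (Multiset ℕ)) : Prop :=
  M.card ≤ n ∧ ∀ B ∈ M, B ≠ 0 ∧ B.card ≤ m ∧ 0 ∉ B

theorem isBlockType_blockType (r : Fin (m * n) → ℕ) : IsBlockType m n (blockType r) := by
  refine ⟨(card_nonzeroValues_le _).trans_eq (Fintype.card_fin n), fun B hB => ?_⟩
  obtain ⟨hB0, b, rfl⟩ := mem_nonzeroValues.1 hB
  exact ⟨hB0, (card_nonzeroValues_le _).trans_eq (Fintype.card_fin m), zero_notMem_nonzeroValues _⟩

theorem IsBlockType.exists_blockType_eq {M : Multiset (Multiset ℕ)} (hM : IsBlockType m n M) :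
    ∃ r : Fin (m * n) → ℕ, blockType r = M := by
  obtain ⟨f, rfl⟩ := exists_nonzeroValues_eq (hM.1.trans_eq (Fintype.card_fin n).symm)
    fun h => (hM.2 0 h).1 rfl
  have hblock (b : Fin n) : ∃ p : Fin m → ℕ, nonzeroValues p = f b := by
    by_cases hb : f b = 0
    · exact exists_nonzeroValues_eq (by simp [hb]) (by simp [hb])
    · have := hM.2 (f b) (mem_nonzeroValues.2 ⟨hb, b, rfl⟩)
      exact exists_nonzeroValues_eq (this.2.1.trans_eq (Fintype.card_fin m).symm) this.2.2
  choose p hp using hblock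
  refine ⟨fun x => p (blockPoint.symm x).1 (blockPoint.symm x).2, ?_⟩
  exact congrArg nonzeroValues (funext fun b => by simp [blockLabels, hp])

end BlockType

/-- The relations satisfied by the coefficients of a vector of a Specht module invariant under the
stabilizer of `n` blocks of size `m`, as a function `g` of the block type: `T` is the multiset of
the nonzero labels, `raise` are the raising relations between nonzero labels, and `insert` is the
raising relation from the label `0` (which block types do not record) to `j`. -/
structure IsHighestWeight (m n : ℕ) (T : Multiset ℕ) (g : Multiset (Multiset ℕ) → ℂ) : Prop where
  isBlockType {M : Multiset (Multiset ℕ)} : g M ≠ 0 → IsBlockType m n M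
  sum_eq {M : Multiset (Multiset ℕ)} : g M ≠ 0 → M.sum = T
  raise (M : Multiset (Multiset ℕ)) {i j : ℕ} (hi : 0 < i) (hij : i < j) :
    (M.map fun B => B.count i * g ((j ::ₘ B.erase i) ::ₘ M.erase B)).sum = 0
  insert {M : Multiset (Multiset ℕ)} (hM : IsBlockType m n M) {j : ℕ} (hj : 0 < j) :
    (M.map fun B => ((m : ℂ) - B.card) * g ((j ::ₘ B) ::ₘ M.erase B)).sum +
      ((n : ℂ) - M.card) * (m * g ({j} ::ₘ M)) = 0

theorem IsBlockType.of_raise {m n : ℕ} {M : Multiset (Multiset ℕ)} {B : Multiset ℕ} {i j : ℕ}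
    (h : IsBlockType m n ((j ::ₘ B.erase i) ::ₘ M.erase B)) (hB : B ∈ M) (hi : i ≠ 0)
    (hiB : i ∈ B) : IsBlockType m n M := by
  obtain ⟨-, hcard, h0⟩ := h.2 _ (Multiset.mem_cons_self _ _)
  refine ⟨?_, fun B' hB' => ?_⟩
  · simpa [Multiset.card_erase_add_one hB] using h.1
  · rcases eq_or_ne B' B with rfl | hne
    · refine ⟨fun h => by simp [h] at hiB, ?_, fun h => h0 ?_⟩
      · simpa [Multiset.card_erase_add_one hiB] using hcard
      · exact Multiset.mem_cons_of_mem ((Multiset.mem_erase_of_ne hi.symm).2 h)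
    · exact h.2 B' (Multiset.mem_cons_of_mem ((Multiset.mem_erase_of_ne hne).2 hB'))

section Specht

variable {μ : YoungDiagram} {m n : ℕ}

open scoped Classical in
/-- The coefficient of the tabloids of block type `M`, well defined on vectors that are invariant
under the block stabilizer. -/
def typeCoeff (m n : ℕ) (M : Multiset (Multiset ℕ)) : (Tabloid μ (m * n) →₀ ℂ) →ₗ[ℂ] ℂ :=
  if h : ∃ r : Fin (m * n) → ℕ, blockType r = M then coeff h.choose else 0

variable {v : Tabloid μ (m * n) →₀ ℂ}

theorem typeCoeff_blockType (hv : ∀ c ∈ blockStabilizer m n, tabloidRep μ (m * n) c v = v)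
    (r : Fin (m * n) → ℕ) : typeCoeff m n (blockType r) v = coeff r v := by
  have h : ∃ r', blockType r' = blockType r := ⟨r, rfl⟩
  obtain ⟨c, hc, hcr⟩ := exists_comp_eq_of_blockType_eq h.choose_spec
  rw [typeCoeff, dif_pos h, ← hcr, ← coeff_tabloidRep, hv c hc]

theorem exists_blockType_eq_of_typeCoeff_ne_zero {M : Multiset (Multiset ℕ)}
    (h : typeCoeff m n M v ≠ 0) : ∃ r : Fin (m * n) → ℕ, blockType r = M := by
  by_contra hM
  exact h (by rw [typeCoeff, dif_neg hM, LinearMap.zero_apply])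

theorem eq_zero_of_typeCoeff_eq_zero
    (hv : ∀ c ∈ blockStabilizer m n, tabloidRep μ (m * n) c v = v)
    (h : ∀ M, typeCoeff m n M v = 0) : v = 0 :=
  eq_zero_of_coeff_eq_zero fun r => by rw [← typeCoeff_blockType hv, h]

theorem count_sum_blockType (r : Fin (m * n) → ℕ) {i : ℕ} (hi : i ≠ 0) :
    (blockType r).sum.count i = (Finset.univ.filter fun x => r x = i).card := by
  have hsum := sum_apply_eq_sum_nonzeroValues (blockLabels r) id
  rw [Multiset.map_id, id_def, smul_zero, add_zero] at hsum
  rw [blockType, ← hsum, Multiset.count_sum', Finset.card_filter, ← Equiv.sum_comp blockPoint,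
    Fintype.sum_prod_type]
  refine Finset.sum_congr rfl fun b _ => ?_
  rw [id_def, blockLabels, count_nonzeroValues _ hi, Fintype.card_subtype, Finset.card_filter]

theorem sum_card_smul_blockLabels_eq_zero (hspecht : v ∈ (spechtModule μ (m * n)).toSubmodule)
    (hv : ∀ c ∈ blockStabilizer m n, tabloidRep μ (m * n) c v = v) (r : Fin (m * n) → ℕ)
    {i j : ℕ} (hij : i < j) :
    ∑ b, (Fintype.card {s // r (blockPoint (b, s)) = i} : ℂ) * typeCoeff m n
      ((j ::ₘ (blockLabels r b).erase i) ::ₘ (blockType r).erase (blockLabels r b)) v = 0 := by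
  rw [← raising_specht hspecht hij r, Finset.sum_filter, ← Equiv.sum_comp blockPoint,
    Fintype.sum_prod_type]
  refine Finset.sum_congr rfl fun b _ => ?_
  rw [← Finset.sum_filter, ← nsmul_eq_mul, Fintype.card_subtype, ← Finset.sum_const]
  refine Finset.sum_congr rfl fun s hs => ?_
  rw [← typeCoeff_blockType hv, blockType_update r _ (Nat.ne_zero_of_lt hij),
    (Finset.mem_filter.1 hs).2]

theorem sum_raise_blockType_eq_zero (hspecht : v ∈ (spechtModule μ (m * n)).toSubmodule)
    (hv : ∀ c ∈ blockStabilizer m n, tabloidRep μ (m * n) c v = v) (r : Fin (m * n) → ℕ)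
    {i j : ℕ} (hi : i ≠ 0) (hij : i < j) :
    ((blockType r).map fun B =>
      B.count i * typeCoeff m n ((j ::ₘ B.erase i) ::ₘ (blockType r).erase B) v).sum = 0 := by
  have hsum := sum_card_smul_blockLabels_eq_zero hspecht hv r hij
  simp only [← count_nonzeroValues _ hi] at hsum
  rw [← hsum]
  symm
  refine (sum_apply_eq_sum_nonzeroValues (blockLabels r) fun B => (B.count i : ℂ) *
    typeCoeff m n ((j ::ₘ B.erase i) ::ₘ (blockType r).erase B) v).trans ?_
  simp [blockType]

theorem sum_insert_blockType_eq_zero (hspecht : v ∈ (spechtModule μ (m * n)).toSubmodule)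
    (hv : ∀ c ∈ blockStabilizer m n, tabloidRep μ (m * n) c v = v) (r : Fin (m * n) → ℕ)
    {j : ℕ} (hj : 0 < j) :
    ((blockType r).map fun B =>
      ((m : ℂ) - B.card) * typeCoeff m n ((j ::ₘ B) ::ₘ (blockType r).erase B) v).sum +
      ((n : ℂ) - (blockType r).card) * (m * typeCoeff m n ({j} ::ₘ blockType r) v) = 0 := by
  have hsum := sum_card_smul_blockLabels_eq_zero hspecht hv r hj
  have hcard (b : Fin n) : (Fintype.card {s // r (blockPoint (b, s)) = 0} : ℂ) =
      m - (blockLabels r b).card := by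
    rw [eq_sub_iff_add_eq', ← Nat.cast_add]
    exact congrArg Nat.cast ((card_nonzeroValues_add _).trans (Fintype.card_fin m))
  have herase (b : Fin n) : (blockLabels r b).erase 0 = blockLabels r b :=
    Multiset.erase_of_notMem (zero_notMem_nonzeroValues _)
  have hempty : (Fintype.card {b // blockLabels r b = 0} : ℂ) = n - (blockType r).card := by
    rw [eq_sub_iff_add_eq', ← Nat.cast_add]
    exact congrArg Nat.cast ((card_nonzeroValues_add _).trans (Fintype.card_fin n))
  simp only [hcard, herase] at hsum
  rw [← hsum, ← hempty, ← nsmul_eq_mul]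
  symm
  refine (sum_apply_eq_sum_nonzeroValues (blockLabels r) fun B => ((m : ℂ) - B.card) *
    typeCoeff m n ((j ::ₘ B) ::ₘ (blockType r).erase B) v).trans ?_
  rw [blockType, Multiset.erase_of_notMem (zero_notMem_nonzeroValues _), Multiset.card_zero,
    Nat.cast_zero, sub_zero]
  rfl

theorem isHighestWeight_typeCoeff (hspecht : v ∈ (spechtModule μ (m * n)).toSubmodule)
    (hv : ∀ c ∈ blockStabilizer m n, tabloidRep μ (m * n) c v = v) {T : Multiset ℕ}
    (h0 : 0 ∉ T) (hT : ∀ i ≠ 0, T.count i = μ.rowLen i) :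
    IsHighestWeight m n T fun M => typeCoeff m n M v where
  isBlockType h := by
    obtain ⟨r, rfl⟩ := exists_blockType_eq_of_typeCoeff_ne_zero h
    exact isBlockType_blockType r
  sum_eq h := by
    obtain ⟨r, rfl⟩ := exists_blockType_eq_of_typeCoeff_ne_zero h
    rw [typeCoeff_blockType hv] at h
    ext i
    rcases eq_or_ne i 0 with rfl | hi
    · rw [Multiset.count_eq_zero_of_notMem h0, Multiset.count_eq_zero]
      intro h0M
      obtain ⟨B, hB, h0B⟩ := Multiset.mem_join.1 h0M
      exact ((isBlockType_blockType r).2 B hB).2.2 h0B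
    · rw [hT i hi, count_sum_blockType r hi, card_row_eq_of_coeff_ne_zero h]
  raise M i j hi hij := by
    by_cases hM : IsBlockType m n M
    swap
    · refine Multiset.sum_eq_zero fun a ha => ?_
      obtain ⟨B, hB, rfl⟩ := Multiset.mem_map.1 ha
      by_contra h
      obtain ⟨hcount, hcoeff⟩ := mul_ne_zero_iff.1 h
      obtain ⟨r, hr⟩ := exists_blockType_eq_of_typeCoeff_ne_zero hcoeff
      exact hM ((hr ▸ isBlockType_blockType r).of_raise hB hi.ne'
        (Multiset.count_ne_zero.1 (Nat.cast_ne_zero.1 hcount)))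
    obtain ⟨r, rfl⟩ := hM.exists_blockType_eq
    exact sum_raise_blockType_eq_zero hspecht hv r hi.ne' hij
  insert hM j hj := by
    obtain ⟨r, rfl⟩ := hM.exists_blockType_eq
    exact sum_insert_blockType_eq_zero hspecht hv r hj

end Specht

/-- The multiset of multisets over which the `i → j` raising relation at `M` is summed. -/
def raises (i j : ℕ) (M : Multiset (Multiset ℕ)) : Multiset (Multiset (Multiset ℕ)) :=
  M.bind fun B => Multiset.replicate (B.count i) ((j ::ₘ B.erase i) ::ₘ M.erase B)

/-- The multisets of at most `k` multisets of size at least `2` and at most `m` with sum `T`. -/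
def reducedTypes (m : ℕ) : ℕ → Multiset ℕ → Multiset (Multiset (Multiset ℕ))
  | 0, T => if T = 0 then {0} else 0
  | k + 1, T => reducedTypes m 0 T +
      (T.powerset.filter fun B => 2 ≤ B.card ∧ B.card ≤ m).bind fun B =>
        (reducedTypes m k (T - B)).map (B ::ₘ ·)

theorem mem_reducedTypes {m k : ℕ} {M : Multiset (Multiset ℕ)} (hk : M.card ≤ k)
    (hM : ∀ B ∈ M, 2 ≤ B.card ∧ B.card ≤ m) : M ∈ reducedTypes m k M.sum := by
  induction k generalizing M with
  | zero => simp [Multiset.card_eq_zero.1 (Nat.le_zero.1 hk), reducedTypes]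
  | succ k ih =>
    induction M using Multiset.induction with
    | empty => simp [reducedTypes]
    | cons B M _ =>
      rw [Multiset.forall_mem_cons] at hM
      simp only [reducedTypes, Multiset.mem_add, Multiset.mem_bind, Multiset.mem_filter,
        Multiset.mem_powerset, Multiset.mem_map, Multiset.sum_cons]
      exact .inr ⟨B, ⟨Multiset.le_add_right _ _, hM.1⟩, M, by
        simpa using ih (by simpa using hk) hM.2, rfl⟩

/-- The types at which a function satisfying the raising relations is forced to vanish if it
vanishes on `S`, using in turn the relations `(i, j, M)` in the list: a relation with all but one of
its terms known to vanish eliminates the remaining one. -/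
def eliminate (S : Multiset (Multiset (Multiset ℕ))) :
    List (ℕ × ℕ × Multiset (Multiset ℕ)) → Multiset (Multiset (Multiset ℕ))
  | [] => S
  | (i, j, M) :: R => eliminate (if 0 < i ∧ i < j ∧ ∀ N ∈ raises i j M, ∀ N' ∈ raises i j M,
      N ∉ S → N' ∉ S → N = N' then S + raises i j M else S) R

namespace IsHighestWeight

variable {m n : ℕ} {T : Multiset ℕ} {g : Multiset (Multiset ℕ) → ℂ}

theorem sum_raises_eq_zero (hg : IsHighestWeight m n T g) {i j : ℕ} (hi : 0 < i) (hij : i < j)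
    (M : Multiset (Multiset ℕ)) : ((raises i j M).map g).sum = 0 := by
  rw [raises, Multiset.map_bind, Multiset.sum_bind, ← hg.raise M hi hij]
  simp

theorem apply_singleton_cons_eq_zero (hg : IsHighestWeight m n T g) {j : ℕ} (hj : 0 < j)
    {M : Multiset (Multiset ℕ)} (hM : IsBlockType m n ({j} ::ₘ M))
    (h : ∀ B ∈ M, g ((j ::ₘ B) ::ₘ M.erase B) = 0) : g ({j} ::ₘ M) = 0 := by
  have hcard : M.card < n := by simpa [Nat.succ_le_iff] using hM.1
  have hm : m ≠ 0 := by have := hM.2 {j} (Multiset.mem_cons_self _ _); aesop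
  have hinsert := hg.insert ⟨hcard.le, fun B hB => hM.2 B (Multiset.mem_cons_of_mem hB)⟩ hj
  rw [Multiset.sum_eq_zero, zero_add] at hinsert
  · have hn : (n : ℂ) - M.card ≠ 0 := sub_ne_zero.2 (Nat.cast_injective.ne hcard.ne')
    simpa [hn, hm] using hinsert
  · intro a ha
    obtain ⟨B, hB, rfl⟩ := Multiset.mem_map.1 ha
    rw [h B hB, mul_zero]

theorem eq_zero_of_two_le_card (hg : IsHighestWeight m n T g)
    (h : ∀ M, IsBlockType m n M → (∀ B ∈ M, 2 ≤ B.card) → M.sum = T → g M = 0) : g = 0 := by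
  funext M
  induction hk : M.card using Nat.strong_induction_on generalizing M with
  | _ k ih =>
    by_contra hgM
    have hM := hg.isBlockType hgM
    obtain ⟨B, hB, hBcard⟩ : ∃ B ∈ M, B.card < 2 := by
      by_contra! hred
      exact hgM (h M hM hred (hg.sum_eq hgM))
    obtain ⟨hB0, -, h0B⟩ := hM.2 B hB
    obtain ⟨j, rfl⟩ := Multiset.card_eq_one.1
      (le_antisymm (Nat.le_of_lt_succ hBcard) (Multiset.card_pos.2 hB0))
    obtain ⟨M, rfl⟩ := Multiset.exists_cons_of_mem hB
    refine hgM (hg.apply_singleton_cons_eq_zero ?_ hM fun B hB => ih M.card ?_ _ ?_)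
    · exact Nat.pos_of_ne_zero (by rintro rfl; simp at h0B)
    · simp [← hk]
    · rw [Multiset.card_cons, Multiset.card_erase_add_one hB]

theorem eq_zero_of_mem_reducedTypes (hg : IsHighestWeight m n T g)
    (h : ∀ M ∈ reducedTypes m (T.card / 2) T, g M = 0) : g = 0 := by
  refine hg.eq_zero_of_two_le_card fun M hM hred hsum => h M ?_
  subst hsum
  refine mem_reducedTypes ?_ fun B hB => ⟨hred B hB, (hM.2 B hB).2.1⟩
  have hcard := Multiset.card_nsmul_le_sum (s := M.map Multiset.card) (a := 2) (by simpa using hred)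
  rwa [Multiset.card_map, ← Multiset.card_join, smul_eq_mul, ← Nat.le_div_iff_mul_le two_pos]
    at hcard

theorem eq_zero_of_eliminate (hg : IsHighestWeight m n T g) {S : Multiset (Multiset (Multiset ℕ))}
    (hS : ∀ M ∈ S, g M = 0) (R : List (ℕ × ℕ × Multiset (Multiset ℕ))) :
    ∀ M ∈ eliminate S R, g M = 0 := by
  induction R generalizing S with
  | nil => exact hS
  | cons p R ih =>
    obtain ⟨i, j, M⟩ := p
    rw [eliminate]
    split_ifs with h
    · refine ih fun N hN => ?_
      obtain hN | hN := Multiset.mem_add.1 hN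
      · exact hS N hN
      by_contra hgN
      have hNS : N ∉ S := fun hNS => hgN (hS N hNS)
      have hne : ∀ N' ≠ N, N' ∈ raises i j M → g N' = 0 := fun N' hN' hmem =>
        hS N' (by_contra fun hN'S => hN' (h.2.2 N' hmem N hN hN'S hNS))
      have hsum := hg.sum_raises_eq_zero h.1 h.2.1 M
      rw [Multiset.sum_map_eq_nsmul_single N hne, smul_eq_zero] at hsum
      exact hsum.elim (Multiset.count_ne_zero.2 hN) hgN
    · exact ih hS

end IsHighestWeight

section AveragedPolytabloid

variable {μ : YoungDiagram} {N : ℕ} (t : Tableau μ N)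

theorem Tableau.polytabloid_smul_tabloid {σ : Equiv.Perm (Fin N)}
    (h : ∀ π ∈ t.colStab, π • t.tabloid = σ • t.tabloid → Equiv.Perm.sign π = 1) :
    t.polytabloid (σ • t.tabloid) =
      Nat.card {π : t.colStab // π.1 • t.tabloid = σ • t.tabloid} := by
  classical
  rw [Tableau.polytabloid_eq_sum, Finsupp.finsetSum_apply, Nat.card_eq_fintype_card,
    Fintype.card_subtype, Finset.card_filter, Nat.cast_sum]
  refine Finset.sum_congr rfl fun π _ => ?_
  rw [Finsupp.single_apply]
  split_ifs with hπ <;> simp [h π.1 π.2, hπ]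

theorem invariants_specht_ne_bot (C : Subgroup (Equiv.Perm (Fin N)))
    (h : ∀ π ∈ t.colStab, π • t.tabloid ∈ MulAction.orbit C t.tabloid → Equiv.Perm.sign π = 1) :
    invariants (V := (spechtModule μ N).toSubmodule)
      ((spechtModule μ N).toRepresentation.comp C.subtype) ≠ ⊥ := by
  classical
  set ρ : Representation ℂ C (spechtModule μ N).toSubmodule :=
    (spechtModule μ N).toRepresentation.comp C.subtype
  have hinv : ρ.norm t.spechtPolytabloid ∈ invariants ρ := fun c => ρ.self_norm_apply c _
  have hnorm : (ρ.norm t.spechtPolytabloid : Tabloid μ N →₀ ℂ) =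
      ∑ c : C, tabloidRep μ N c t.polytabloid := by
    rw [Representation.norm, LinearMap.sum_apply, Submodule.coe_sum]
    rfl
  have hcoeff (c : C) : tabloidRep μ N c t.polytabloid t.tabloid =
      Nat.card {π : t.colStab // π.1 • t.tabloid = c.1⁻¹ • t.tabloid} := by
    have hc := t.polytabloid_smul_tabloid (σ := c.1⁻¹) fun π hπ hc => h π hπ ⟨c⁻¹, hc.symm⟩
    rw [← hc]
    conv_lhs => rw [← smul_inv_smul c.1 t.tabloid]
    exact Finsupp.mapDomain_apply (MulAction.injective c.1) _ _
  intro hbot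
  rw [hbot, Submodule.mem_bot] at hinv
  have hsum := DFunLike.congr_fun (hnorm.symm.trans (congrArg Subtype.val hinv)) t.tabloid
  rw [Finsupp.finsetSum_apply, Finset.sum_congr rfl fun c _ => hcoeff c, ← Nat.cast_sum] at hsum
  have hzero := Finset.sum_eq_zero_iff.1 (Nat.cast_eq_zero.1 hsum) 1 (Finset.mem_univ _)
  have : Nonempty {π : t.colStab // π.1 • t.tabloid = (1 : C).1⁻¹ • t.tabloid} := ⟨1, by simp⟩
  exact Nat.card_pos.ne' hzero

end AveragedPolytabloid

/-- The sum of the products of the labels of the pairs of indices with positions in a common block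
of size `m`. -/
def blockEnergy {ι : Type*} [Fintype ι] (m : ℕ) (pos r : ι → ℕ) : ℕ :=
  ∑ a, ∑ b, if pos a / m = pos b / m then r a * r b else 0

theorem blockEnergy_comp_of_injective {ι κ : Type*} [Fintype ι] [Fintype κ] (m : ℕ)
    {pos r : κ → ℕ} {p : ι → κ} (hp : p.Injective) (hr : ∀ x ∉ Set.range p, r x = 0) :
    blockEnergy m (pos ∘ p) (r ∘ p) = blockEnergy m pos r := by
  refine Fintype.sum_of_injective p hp _ _ (fun x hx => by simp [hr x hx]) fun a => ?_
  exact Fintype.sum_of_injective p hp _ _ (fun y hy => by simp [hr y hy]) fun b => rfl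

theorem blockEnergy_comp_of_mem_blockStabilizer {m n : ℕ} {c : Equiv.Perm (Fin (m * n))}
    (hc : c ∈ blockStabilizer m n) (r : Fin (m * n) → ℕ) :
    blockEnergy m Fin.val (r ∘ c) = blockEnergy m Fin.val r := by
  refine Fintype.sum_equiv c _ _ fun x => Fintype.sum_equiv c _ _ fun y => ?_
  simp only [hc x y, Function.comp_apply]

variable {μ : YoungDiagram} {N k : ℕ} {h : Fin k → ℕ}

/-- The tableau `t` has the entry `p ⟨c, i⟩` in row `i` of column `c`, and all its other entries
are in the first row. -/
structure Tableau.ExtendsFilling (t : Tableau μ N) (p : (Σ c, Fin (h c)) → Fin N) : Prop where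
  row_apply (d) : t.tabloid.1 (p d) = d.2
  col_apply (d) : t.col (p d) = d.1
  row_eq_zero : ∀ x ∉ Set.range p, t.tabloid.1 x = 0

theorem exists_extendsFilling (hμ : μ.card = N) {p : (Σ c, Fin (h c)) → Fin N} (hp : p.Injective)
    (hh : ∀ i (c : Fin k), (i, (c : ℕ)) ∈ μ ↔ i < h c) (hk : ∀ i c, k ≤ c → (i, c) ∈ μ → i = 0) :
    ∃ t : Tableau μ N, t.ExtendsFilling p := by
  classical
  obtain ⟨t⟩ := exists_tableau hμ
  choose q hrow hcol using fun d : Σ c, Fin (h c) => t.exists_row_col ((hh d.2 d.1).2 d.2.2)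
  have hq : q.Injective := by
    rintro ⟨c, i⟩ ⟨c', i'⟩ hd
    obtain rfl : c = c' := Fin.ext (by rw [← hcol ⟨c, i⟩, hd, hcol])
    obtain rfl : i = i' := Fin.ext (by rw [← hrow ⟨c, i⟩, hd, hrow])
    rfl
  let e := (Equiv.ofInjective q hq).symm.trans (Equiv.ofInjective p hp)
  let σ : Equiv.Perm (Fin N) := e.extendSubtype
  have hσ (d) : σ⁻¹ (p d) = q d := by
    rw [Equiv.Perm.inv_eq_iff_eq, Equiv.extendSubtype_apply_of_mem e _ ⟨d, rfl⟩]
    simp [e]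
  refine ⟨t.perm σ, fun d => ?_, fun d => ?_, fun x hx => ?_⟩
  · exact (congrArg t.tabloid.1 (hσ d)).trans (hrow d)
  · exact (congrArg t.col (hσ d)).trans (hcol d)
  · change t.tabloid.1 (σ⁻¹ x) = 0
    have hmem := t.mem_shape (σ⁻¹ x)
    by_contra h0
    have hlt : t.col (σ⁻¹ x) < k := not_le.1 fun hle => h0 (hk _ _ hle hmem)
    let d : Σ c, Fin (h c) := ⟨⟨_, hlt⟩, ⟨_, (hh _ ⟨_, hlt⟩).1 hmem⟩⟩
    exact hx ⟨d, σ⁻¹.injective ((hσ d).trans (t.tabloid_injOn_col (hcol d) (hrow d)))⟩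

namespace Tableau.ExtendsFilling

variable {t : Tableau μ N} {p : (Σ c, Fin (h c)) → Fin N}

theorem injective (ht : t.ExtendsFilling p) : p.Injective := by
  rintro ⟨c, i⟩ ⟨c', i'⟩ hd
  obtain rfl : c = c' := Fin.ext (by rw [← ht.col_apply ⟨c, i⟩, hd, ht.col_apply])
  obtain rfl : i = i' := Fin.ext (by rw [← ht.row_apply ⟨c, i⟩, hd, ht.row_apply])
  rfl

theorem exists_apply_eq (ht : t.ExtendsFilling p) {π : Equiv.Perm (Fin N)} (hπ : π ∈ t.colStab)
    (c : Fin k) (i : Fin (h c)) : ∃ j, π (p ⟨c, i⟩) = p ⟨c, j⟩ := by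
  have hcol : t.col (π (p ⟨c, i⟩)) = c := (hπ _).trans (ht.col_apply _)
  by_cases hmem : π (p ⟨c, i⟩) ∈ Set.range p
  · obtain ⟨⟨c', j⟩, hd⟩ := hmem
    obtain rfl : c' = c := Fin.ext (by rw [← hcol, ← hd, ht.col_apply])
    exact ⟨j, hd.symm⟩
  · refine ⟨⟨0, i.pos⟩, t.tabloid_injOn_col (by rw [hcol, ht.col_apply]) ?_⟩
    rw [ht.row_eq_zero _ hmem, ht.row_apply]

theorem apply_eq_self (ht : t.ExtendsFilling p) {π : Equiv.Perm (Fin N)} (hπ : π ∈ t.colStab)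
    {x : Fin N} (hx : x ∉ Set.range p) : π x = x := by
  refine t.tabloid_injOn_col (hπ x) ?_
  rw [ht.row_eq_zero x hx, ht.row_eq_zero]
  rintro ⟨⟨c, i⟩, hd⟩
  obtain ⟨j, hj⟩ := ht.exists_apply_eq (inv_mem hπ) c i
  exact hx ⟨⟨c, j⟩, by rw [← hj, hd]; simp⟩

theorem exists_eq_viaFintypeEmbedding (ht : t.ExtendsFilling p) {π : Equiv.Perm (Fin N)}
    (hπ : π ∈ t.colStab) : ∃ V : ∀ c, Equiv.Perm (Fin (h c)),
      π = (Equiv.Perm.sigmaCongrRight V).viaFintypeEmbedding ⟨p, ht.injective⟩ := by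
  choose f hf using ht.exists_apply_eq hπ
  have hinj (c) : (f c).Injective := fun i j hij => by
    have := (hf c i).trans ((congrArg (fun i => p ⟨c, i⟩) hij).trans (hf c j).symm)
    simpa using ht.injective (π.injective this)
  let V (c : Fin k) : Equiv.Perm (Fin (h c)) :=
    .ofBijective (f c) (Finite.injective_iff_bijective.1 (hinj c))
  refine ⟨V, Equiv.ext fun x => ?_⟩
  by_cases hx : x ∈ Set.range p
  · obtain ⟨⟨c, i⟩, rfl⟩ := hx
    exact (hf c i).trans (Equiv.Perm.viaFintypeEmbedding_apply_image
      (Equiv.Perm.sigmaCongrRight V) ⟨p, ht.injective⟩ ⟨c, i⟩).symm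
  · rw [ht.apply_eq_self hπ hx]
    exact (Equiv.Perm.viaFintypeEmbedding_apply_notMem_range _ ⟨p, ht.injective⟩ hx).symm

theorem sign_eq_one_of_mem_orbit {m n : ℕ} {t : Tableau μ (m * n)}
    {p : (Σ c, Fin (h c)) → Fin (m * n)} (ht : t.ExtendsFilling p)
    (hp : ∀ V : ∀ c, Equiv.Perm (Fin (h c)),
      blockEnergy m (Fin.val ∘ p) (fun d => V d.1 d.2) =
        blockEnergy m (Fin.val ∘ p) (fun d => d.2) →
      Equiv.Perm.sign (Equiv.Perm.sigmaCongrRight V) = 1)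
    {π : Equiv.Perm (Fin (m * n))} (hπ : π ∈ t.colStab)
    (horbit : π • t.tabloid ∈ MulAction.orbit (blockStabilizer m n) t.tabloid) :
    Equiv.Perm.sign π = 1 := by
  obtain ⟨c, hc⟩ := horbit
  have henergy : blockEnergy m Fin.val (t.tabloid.1 ∘ ⇑π⁻¹) = blockEnergy m Fin.val t.tabloid.1 :=
    (congrArg (fun r : Tabloid μ (m * n) => blockEnergy m Fin.val r.1) hc.symm).trans
      (blockEnergy_comp_of_mem_blockStabilizer (inv_mem c.2) t.tabloid.1)
  obtain ⟨V, hV⟩ := ht.exists_eq_viaFintypeEmbedding (inv_mem hπ)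
  rw [← Equiv.Perm.sign_inv, hV, Equiv.Perm.viaFintypeEmbedding_sign]
  refine hp V ?_
  rw [← blockEnergy_comp_of_injective m ht.injective ht.row_eq_zero,
    ← blockEnergy_comp_of_injective m ht.injective fun x hx => by
      rw [Function.comp_apply, ht.apply_eq_self (inv_mem hπ) hx, ht.row_eq_zero x hx]] at henergy
  convert henergy using 2 <;> ext d
  · rw [Function.comp_apply, Function.comp_apply, hV]
    have := Equiv.Perm.viaFintypeEmbedding_apply_image (Equiv.Perm.sigmaCongrRight V)
      ⟨p, ht.injective⟩ d
    exact (ht.row_apply _).symm.trans (congrArg t.tabloid.1 this.symm)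
  · exact (ht.row_apply d).symm

end Tableau.ExtendsFilling

/-- The entry in row `i` of column `c`, where `d = ⟨c, i⟩`, of the partial filling `K`, given as the
list of its columns read from top to bottom. -/
def fillingEntry (K : List (List ℕ)) (d : Σ c : Fin K.length, Fin (K.get c).length) : ℕ :=
  (K.get d.1).get d.2

/-- `K` lists the first `l₁` columns of a tableau with pattern `(*, l)` whose further columns have
height `1`, and every rearrangement of these columns that keeps the energy of the row labels with
respect to the blocks of size `m` is even. -/
abbrev IsEvenPlacement (m : ℕ) (l : List ℕ) (K : List (List ℕ)) : Prop :=
  (fillingEntry K).Injective ∧ K.length = l.getD 0 0 ∧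
  (∀ c : Fin K.length, 0 < (K.get c).length ∧
    ∀ i ≤ l.length, c < l.getD i 0 ↔ i + 1 < (K.get c).length) ∧
  ∀ V : ∀ c, Equiv.Perm (Fin (K.get c).length),
    blockEnergy m (fillingEntry K) (fun d => V d.1 d.2) =
      blockEnergy m (fillingEntry K) (fun d => d.2) →
    Equiv.Perm.sign (Equiv.Perm.sigmaCongrRight V) = 1

/-- The multiset of the row indices, starting from `0`, of the boxes outside the first row of a
Young diagram with pattern `(*, l)`. -/
def lowerContent (l : List ℕ) : Multiset ℕ :=
  ∑ i ∈ Finset.range l.length, Multiset.replicate (l.getD i 0) (i + 1)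

theorem zero_notMem_lowerContent (l : List ℕ) : 0 ∉ lowerContent l := by
  simp [lowerContent, Multiset.mem_sum, Multiset.mem_replicate]

theorem count_succ_lowerContent (l : List ℕ) (i : ℕ) :
    (lowerContent l).count (i + 1) = l.getD i 0 := by
  simp only [lowerContent, Multiset.count_sum', Multiset.count_replicate, add_left_inj,
    Finset.sum_ite_eq', Finset.mem_range, ite_eq_left_iff, not_lt]
  exact fun hi => (List.getD_eq_default _ _ hi).symm

theorem card_eq_sum_rowLens (μ : YoungDiagram) : μ.card = μ.rowLens.sum := by
  obtain ⟨t⟩ := exists_tableau (rfl : μ.card = μ.card)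
  have hlt (x : Fin μ.card) : t.tabloid.1 x < μ.colLen 0 := YoungDiagram.mem_iff_lt_colLen.1
    (μ.up_left_mem le_rfl (Nat.zero_le _) (t.mem_shape x))
  have hcard := card_tabloid_lt t.tabloid (μ.colLen 0)
  rw [Finset.filter_true_of_mem fun x _ => hlt x, Finset.card_univ, Fintype.card_fin] at hcard
  exact hcard

theorem exists_hasPattern {a : ℕ} {l : List ℕ} (hl : (a :: l).SortedGE)
    (hpos : ∀ x ∈ a :: l, 0 < x) : ∃ μ, HasPattern (a + l.sum) l μ := by
  have hμ := YoungDiagram.rowLens_ofRowLens_eq_self (hw := hl) hpos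
  exact ⟨YoungDiagram.ofRowLens _ hl, by rw [card_eq_sum_rowLens, hμ, List.sum_cons], a, hμ⟩

/-- The subspace of the Specht module `S^μ` fixed by the block stabilizer `C_{m,n}`. -/
def blockInvariants (μ : YoungDiagram) (m n : ℕ) :
    Submodule ℂ (spechtModule μ (m * n)).toSubmodule :=
  invariants (V := (spechtModule μ (m * n)).toSubmodule)
    ((spechtModule μ (m * n)).toRepresentation.comp (blockStabilizer m n).subtype)

instance finiteDimensional_spechtModule (μ : YoungDiagram) (N : ℕ) :
    FiniteDimensional ℂ (spechtModule μ N).toSubmodule :=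
  FiniteDimensional.span_of_finite ℂ (Set.finite_range _)

theorem mult_eq_zero_iff {μ : YoungDiagram} {n : ℕ} (h : μ.card = 3 * n) :
    mult μ n = 0 ↔ blockInvariants μ 3 n = ⊥ := by
  have := isIrreducible_specht h
  exact irrepMultiplicity_ind_trivial_eq_zero_iff _ _

theorem mult_le_one {μ : YoungDiagram} {n : ℕ} (h : μ.card = 3 * n)
    (f : (Tabloid μ (3 * n) →₀ ℂ) →ₗ[ℂ] ℂ)
    (hf : ∀ v ∈ blockInvariants μ 3 n, f v = 0 → v = 0) : mult μ n ≤ 1 := by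
  have := isIrreducible_specht h
  exact irrepMultiplicity_ind_trivial_le_one _ _ (f ∘ₗ Submodule.subtype _) hf

namespace HasPattern

variable {N m n : ℕ} {l : List ℕ} {μ : YoungDiagram}

theorem rowLen_succ (h : HasPattern N l μ) (i : ℕ) : μ.rowLen (i + 1) = l.getD i 0 := by
  obtain ⟨-, a, ha⟩ := h
  have hlen : l.length + 1 = μ.colLen 0 := by rw [← YoungDiagram.length_rowLens, ha]; rfl
  by_cases hi : i < l.length
  · have hget := YoungDiagram.get_rowLens (μ := μ) (i := i + 1) (h := by rw [ha]; simpa using hi)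
    simp [← hget, ha, hi]
  · rw [List.getD_eq_default _ _ (not_lt.1 hi)]
    by_contra h0
    have hmem := YoungDiagram.mem_iff_lt_rowLen.2 (Nat.pos_of_ne_zero h0)
    have := YoungDiagram.mem_iff_lt_colLen.1 hmem
    omega

theorem count_lowerContent (h : HasPattern N l μ) {i : ℕ} (hi : i ≠ 0) :
    (lowerContent l).count i = μ.rowLen i := by
  obtain ⟨i, rfl⟩ := Nat.exists_eq_succ_of_ne_zero hi
  rw [count_succ_lowerContent, h.rowLen_succ]

theorem exists_extendsFilling (h : HasPattern (m * n) l μ) {K : List (List ℕ)}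
    (hK : IsEvenPlacement m l K) (hlt : ∀ d, fillingEntry K d < m * n) :
    ∃ t : Tableau μ (m * n), t.ExtendsFilling fun d => ⟨fillingEntry K d, hlt d⟩ := by
  obtain ⟨hinj, hlen, hcol, -⟩ := hK
  have hrow1 : μ.rowLen 1 = K.length := by rw [hlen, ← h.rowLen_succ]
  refine BV.exists_extendsFilling h.1 (fun d e hde => hinj (congrArg Fin.val hde))
    (fun i c => ?_) fun i c hc hi => ?_
  · rw [YoungDiagram.mem_iff_lt_rowLen]
    obtain ⟨hpos, hc⟩ := hcol c
    obtain _ | i := i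
    · exact iff_of_true (c.2.trans_le (hrow1 ▸ μ.rowLen_anti 0 1 zero_le_one)) hpos
    · rw [h.rowLen_succ]
      obtain hi | hi := le_or_gt i l.length
      · exact hc i hi
      · have := (hc l.length le_rfl).not.1 (by simp)
        rw [List.getD_eq_default _ _ hi.le]
        omega
  · by_contra hi0
    have hanti := μ.rowLen_anti 1 i (Nat.one_le_iff_ne_zero.2 hi0)
    exact absurd (YoungDiagram.mem_iff_lt_rowLen.1 hi) (by omega)

theorem blockInvariants_ne_bot (h : HasPattern (m * n) l μ) {K : List (List ℕ)}
    (hK : IsEvenPlacement m l K) (hlt : ∀ d, fillingEntry K d < m * n) :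
    blockInvariants μ m n ≠ ⊥ := by
  obtain ⟨t, ht⟩ := h.exists_extendsFilling hK hlt
  exact invariants_specht_ne_bot t _ fun π hπ => ht.sign_eq_one_of_mem_orbit hK.2.2.2 hπ

theorem eq_zero_of_eliminate (h : HasPattern (m * n) l μ)
    {S : Multiset (Multiset (Multiset ℕ))} {R : List (ℕ × ℕ × Multiset (Multiset ℕ))}
    (hR : ∀ M ∈ reducedTypes m ((lowerContent l).card / 2) (lowerContent l), M ∈ eliminate S R)
    {v : (spechtModule μ (m * n)).toSubmodule}
    (hv : v ∈ blockInvariants μ m n)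
    (hS : ∀ M ∈ S, typeCoeff m n M v.1 = 0) : v = 0 := by
  have hinv : ∀ c ∈ blockStabilizer m n, tabloidRep μ (m * n) c v.1 = v.1 :=
    fun c hc => congrArg Subtype.val (hv ⟨c, hc⟩)
  have hg := isHighestWeight_typeCoeff v.2 hinv (zero_notMem_lowerContent l)
    fun i hi => h.count_lowerContent hi
  have hzero := hg.eq_zero_of_mem_reducedTypes fun M hM => hg.eq_zero_of_eliminate hS R M (hR M hM)
  exact Subtype.ext (eq_zero_of_typeCoeff_eq_zero hinv (congrFun hzero))

theorem mult_eq_zero (h : HasPattern (3 * n) l μ) (R : List (ℕ × ℕ × Multiset (Multiset ℕ)))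
    (hR : ∀ M ∈ reducedTypes 3 ((lowerContent l).card / 2) (lowerContent l), M ∈ eliminate 0 R) :
    mult μ n = 0 :=
  (mult_eq_zero_iff h.1).2 ((Submodule.eq_bot_iff _).2 fun _ hv =>
    h.eq_zero_of_eliminate hR hv (by simp))

theorem mult_eq_one (h : HasPattern (3 * n) l μ) {K : List (List ℕ)} {B : ℕ}
    (hK : IsEvenPlacement 3 l K) (hB : ∀ d, fillingEntry K d < B) (hBn : B ≤ 3 * n)
    (M₀ : Multiset (Multiset ℕ)) (R : List (ℕ × ℕ × Multiset (Multiset ℕ)))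
    (hR : ∀ M ∈ reducedTypes 3 ((lowerContent l).card / 2) (lowerContent l),
      M ∈ eliminate {M₀} R) : mult μ n = 1 := by
  refine le_antisymm (mult_le_one h.1 (typeCoeff 3 n M₀) fun v hv hv0 =>
    h.eq_zero_of_eliminate hR hv (by simpa using hv0)) (Order.one_le_iff_ne_zero.2 fun h0 => ?_)
  exact h.blockInvariants_ne_bot hK (fun d => (hB d).trans_le hBn) ((mult_eq_zero_iff h.1).1 h0)

end HasPattern

theorem exists_hasPattern_of_mem {n : ℕ} (hn : 5 ≤ n) {l : List ℕ}
    (hl : l ∈ ([[], [2], [3], [4], [2, 2], [5], [4, 1], [3, 2]] : List (List ℕ))) :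
    ∃ μ, HasPattern (3 * n) l μ := by
  have hfacts : l.sum ≤ 5 ∧ l.Pairwise (· ≥ ·) ∧ ∀ x ∈ l, 0 < x ∧ x ≤ 5 := by
    revert l
    decide
  obtain ⟨hsum, hsorted, hparts⟩ := hfacts
  obtain ⟨a, ha⟩ := Nat.exists_eq_add_of_le' (show l.sum ≤ 3 * n by omega)
  rw [ha]
  refine exists_hasPattern ?_ (List.forall_mem_cons.2 ⟨by omega, fun x hx => (hparts x hx).1⟩)
  exact List.sortedGE_iff_pairwise.2 (List.pairwise_cons.2
    ⟨fun x hx => (hparts x hx).2.trans (by omega), hsorted⟩)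

theorem mult_eq_one_of_mem {n : ℕ} (hn : 5 ≤ n) {l : List ℕ} {μ : YoungDiagram}
    (hl : l ∈ ([[], [2], [3], [4], [2, 2], [5], [4, 1], [3, 2]] : List (List ℕ)))
    (h : HasPattern (3 * n) l μ) : mult μ n = 1 := by
  have hn' : 15 ≤ 3 * n := by omega
  simp only [List.mem_cons, List.not_mem_nil, or_false] at hl
  -- The placements `K` were found by a random search.
  rcases hl with rfl | rfl | rfl | rfl | rfl | rfl | rfl | rfl
  · exact h.mult_eq_one (K := []) (by decide +kernel) (by decide +kernel) hn' 0 []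
      (by decide +kernel)
  · exact h.mult_eq_one (K := [[12, 1], [7, 0]]) (by decide +kernel) (by decide +kernel) hn'
      {{1, 1}} [] (by decide +kernel)
  · exact h.mult_eq_one (K := [[2, 3], [1, 4], [8, 5]]) (by decide +kernel) (by decide +kernel)
      hn' {{1, 1, 1}} [] (by decide +kernel)
  · exact h.mult_eq_one (K := [[4, 9], [6, 14], [2, 13], [7, 11]]) (by decide +kernel)
      (by decide +kernel) hn' {{1, 1}, {1, 1}} [] (by decide +kernel)
  · exact h.mult_eq_one (K := [[9, 0, 3], [12, 1, 4]]) (by decide +kernel) (by decide +kernel)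
      hn' {{1, 2}, {1, 2}} [(1, 2, {{1, 2}, {1, 1}})] (by decide +kernel)
  · exact h.mult_eq_one (K := [[10, 14], [11, 12], [5, 0], [7, 1], [4, 13]])
      (by decide +kernel) (by decide +kernel) hn' {{1, 1, 1}, {1, 1}} [] (by decide +kernel)
  · exact h.mult_eq_one (K := [[8, 2, 13], [11, 12], [3, 1], [5, 14]]) (by decide +kernel)
      (by decide +kernel) hn' {{1, 2}, {1, 1, 1}} [(1, 2, {{1, 1}, {1, 1, 1}})]
      (by decide +kernel)
  · exact h.mult_eq_one (K := [[1, 6, 12], [11, 8, 13], [0, 14]]) (by decide +kernel)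
      (by decide +kernel) hn' {{1, 1, 2}, {1, 2}}
      [(1, 2, {{1, 1}, {1, 1, 2}}), (1, 2, {{1, 2}, {1, 1, 1}})] (by decide +kernel)

theorem mult_eq_zero_of_mem {n : ℕ} {l : List ℕ} {μ : YoungDiagram}
    (hl : l ∈ ([[1], [2, 1], [3, 1], [2, 2, 1], [3, 1, 1], [4, 1, 1]] : List (List ℕ)))
    (h : HasPattern (3 * n) l μ) : mult μ n = 0 := by
  simp only [List.mem_cons, List.not_mem_nil, or_false] at hl
  rcases hl with rfl | rfl | rfl | rfl | rfl | rfl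
  · exact h.mult_eq_zero [] (by decide +kernel)
  · exact h.mult_eq_zero [(1, 2, {{1, 1, 1}})] (by decide +kernel)
  · exact h.mult_eq_zero [(1, 2, {{1, 1}, {1, 1}})] (by decide +kernel)
  · exact h.mult_eq_zero [(2, 3, {{1, 1}, {2, 2, 2}}), (1, 2, {{1, 1}, {1, 2, 3}}),
      (2, 3, {{1, 2}, {1, 2, 2}}), (1, 2, {{1, 2}, {1, 1, 3}}), (2, 3, {{2, 2}, {1, 1, 2}})]
      (by decide +kernel)
  · exact h.mult_eq_zero [(2, 3, {{2, 2}, {1, 1, 1}}), (2, 3, {{1, 1}, {1, 2, 2}}),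
      (1, 2, {{1, 3}, {1, 1, 1}}), (2, 3, {{1, 2}, {1, 1, 2}})] (by decide +kernel)
  · exact h.mult_eq_zero [(2, 3, {{1, 2}, {1, 2}, {1, 1}}), (2, 3, {{1, 1, 2}, {1, 1, 2}}),
      (2, 3, {{2, 2}, {1, 1}, {1, 1}}), (2, 3, {{1, 2, 2}, {1, 1, 1}})] (by decide +kernel)

end

end BV

theorem mainTheorem4 :
    (∀ n : ℕ, 5 ≤ n →
      ∀ l ∈ ([[], [2], [3], [4], [2, 2], [5], [4, 1], [3, 2]] : List (List ℕ)),
        (∃ μ : YoungDiagram, BV.HasPattern (3 * n) l μ) ∧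
        ∀ μ : YoungDiagram, BV.HasPattern (3 * n) l μ → BV.mult μ n = 1) ∧
    (∀ n : ℕ,
      ∀ l ∈ ([[1], [2, 1], [3, 1], [2, 2, 1], [3, 1, 1], [4, 1, 1]] : List (List ℕ)),
        ∀ μ : YoungDiagram, BV.HasPattern (3 * n) l μ → BV.mult μ n = 0) :=
  ⟨fun _ hn _ hl => ⟨BV.exists_hasPattern_of_mem hn hl, fun _ => BV.mult_eq_one_of_mem hn hl⟩,
    fun _ _ hl _ => BV.mult_eq_zero_of_mem hl⟩
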